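/- Let $\mathbb F$ be the category of finite sets and $\mathbb S$ the category of sets. Write $[\mathbb F,\mathbb S]_\circ$ for the category of functors $\mathbb F\to\mathbb S$ with the substitution monoidal structure $(F\circ G)(X)=\int^{C} F\,C\times (C\to G X)$, whose unit is the inclusion $i:\mathbb F\to\mathbb S$. Monoids in it are finitary monads. A strong profunctor is a functor $P:\mathbb F^{\mathrm{op}}\times\mathbb F\to\mathbb S$ with maps $\mathrm{str}_{X,Y,Z}:P(X,Y)\to P(X\times Z,Y\times Z)$, natural in $X,Y$ and dinatural in $Z$, such that $P(\mathrm{id},\pi_1)\circ\mathrm{str}_{X,Y,1}=P(\pi_1,\mathrm{id})$ and $\mathrm{str}_{X\times V,Y\times V,W}\circ\mathrm{str}_{X,Y,V}=P(\alpha^{-1},\alpha)\circ\mathrm{str}_{X,Y,V\times W}$, where $\alpha: A\times(B\times C)\cong(A\times B)\times C$. With natural transformations commuting with the strengths, strong profunctors form a category $\mathrm{Prof}_s$. It is monoidal under $(P\otimes Q)(X,Y)=\int^W P(X,W)\times Q(W,Y)$ with strength $[p,q]\mapsto[\mathrm{str}_Z\,p,\mathrm{str}_Z\,q]$; the unit is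 $\mathrm{Hom}$ with strength $f\mapsto f\times\mathrm{id}$. Monoids in $\mathrm{Prof}_s$ are called arrows: the unit gives $\mathrm{arr}:\mathrm{Hom}(X,Y)\to P(X,Y)$ and the multiplication gives the composition $\ggg$. Let $(-)^*:\mathrm{Prof}_s\to[\mathbb F,\mathbb S]$, $P^*(Z)=P(1,Z)$. It is left adjoint to $(-)_*$, where $F_*(X,Y)=(X\to F Y)$ with strength $v\mapsto\bigl((x,z)\mapsto F(y\mapsto(y,z))(v(x))\bigr)$. The unit is $\eta_P(p)(x)=P(x,\mathrm{id})(p)$, where $x\in X$ is seen as a map $1\to X$, and the counit is evaluation at the element of $1$. The functor $(-)_*$ is (lax) monoidal, through $\xi_0:\mathrm{Hom}\to i_*$, the identity maps $\mathrm{Hom}(X,Y)\to(X\to Y)$, and $\xi_{F,G}:F_*\otimes G_*\to(F\circ G)_*$, $[v,w]\mapsto(x\mapsto[v(x),w])$. Let $\Diamond P=(P^*)_*$ be the monad of the adjunction. A $\Diamond$-monoid is a monoid in $\mathrm{Prof}_s$ together with a $\Diamond$-algebra structure on its underlying object. Morphisms of $\Diamond$-monoids are morphisms of monoids that are also morphisms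 of $\Diamond$-algebras. Then: 1. The morphism $(\xi_0)^*:\mathrm{Hom}^*\to(i_*)^*$ is invertible. For every strong profunctor $P$ and every $F:\mathbb F\to\mathbb S$, the morphism $(\xi_{P^*,F}\circ(\eta_P\otimes\mathrm{id}_{F_*}))^*:(P\otimes F_*)^*\to((P^*\circ F)_*)^*$ is invertible. 2. The categories $\mathrm{Mon}([\mathbb F,\mathbb S]_\circ)$ and $\mathrm{Mon}(\Diamond)$ are equivalent. The equivalence can be chosen so that its composite with the forgetful functor $\mathrm{Mon}(\Diamond)\to\mathrm{Mon}(\mathrm{Prof}_s)$ is naturally isomorphic to the functor $\mathrm{Mon}([\mathbb F,\mathbb S]_\circ)\to\mathrm{Mon}(\mathrm{Prof}_s)$ induced by the monoidal functor $((-)_*,\xi,\xi_0)$. 3. The forgetful functor $\mathrm{Mon}(\Diamond)\to\mathrm{Mon}(\mathrm{Prof}_s)$ is fully faithful. An arrow $P$ carries a $\Diamond$-algebra structure if and only if, for all finite sets $A$ and $B$, the map $\mathrm{eval}:P(A,B)\to(A\to P(1,B))$, $\mathrm{eval}(c)(a)=\mathrm{arr}(\lambda().\,a)\ggg c$, is bijective.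 -/

import Mathlib

open CategoryTheory MonoidalCategory Opposite

universe u

namespace Computation

noncomputable section

/-! ### Finite sets -/

/-- The product of two finite sets. -/
abbrev fprod (X Y : FintypeCat.{u}) : FintypeCat.{u} := FintypeCat.of (X × Y)

/-- The terminal finite set `1`. -/
abbrev fone : FintypeCat.{u} := FintypeCat.of PUnit.{u + 1}

/-- The product `f × g` of two maps of finite sets. -/
def fmap₂ {X X' Y Y' : FintypeCat.{u}} (f : X ⟶ X') (g : Y ⟶ Y') : fprod X Y ⟶ fprod X' Y' :=
  FintypeCat.homMk fun p => (f p.1, g p.2)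

@[simp]
theorem fmap₂_id (X Y : FintypeCat.{u}) : fmap₂ (𝟙 X) (𝟙 Y) = 𝟙 (fprod X Y) := rfl

/-- The first projection. -/
def fproj₁ (X Y : FintypeCat.{u}) : fprod X Y ⟶ X := FintypeCat.homMk fun p => p.1

/-- The associativity map `X × (Y × Z) ⟶ (X × Y) × Z`. -/
def fassoc (X Y Z : FintypeCat.{u}) : fprod X (fprod Y Z) ⟶ fprod (fprod X Y) Z :=
  FintypeCat.homMk fun p => ((p.1, p.2.1), p.2.2)

/-- The inverse associativity map `(X × Y) × Z ⟶ X × (Y × Z)`. -/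
def fassocInv (X Y Z : FintypeCat.{u}) : fprod (fprod X Y) Z ⟶ fprod X (fprod Y Z) :=
  FintypeCat.homMk fun p => (p.1.1, (p.1.2, p.2))

@[simp]
theorem fassoc_fassocInv (X Y Z : FintypeCat.{u}) :
    fassoc X Y Z ≫ fassocInv X Y Z = 𝟙 (fprod X (fprod Y Z)) := rfl

/-- The map `1 ⟶ X` with value `x`. -/
def fpoint {X : FintypeCat.{u}} (x : X) : fone ⟶ X := FintypeCat.homMk fun _ => x

/-- The map `y ↦ (y, z)`. -/
def fpair (Y : FintypeCat.{u}) {Z : FintypeCat.{u}} (z : Z) : Y ⟶ fprod Y Z :=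
  FintypeCat.homMk fun y => (y, z)

/-! ### Coends -/

/-- The relation generating the coend of `A W × B W`: for `f : W ⟶ W'`, `a ∈ A W` and `b ∈ B W'`,
the pairs `(a, B f b)` and `(A f a, b)` are identified. -/
inductive CoendRel (A : FintypeCat.{u} ⥤ Type u) (B : FintypeCat.{u}ᵒᵖ ⥤ Type u) :
    (Σ W : FintypeCat.{u}, A.obj W × B.obj (op W)) →
      (Σ W : FintypeCat.{u}, A.obj W × B.obj (op W)) → Prop
  | glue {W W' : FintypeCat.{u}} (f : W ⟶ W') (a : A.obj W) (b : B.obj (op W')) :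
      CoendRel A B ⟨W, (a, B.map f.op b)⟩ ⟨W', (A.map f a, b)⟩

instance coend_small (A : FintypeCat.{u} ⥤ Type u) (B : FintypeCat.{u}ᵒᵖ ⥤ Type u) :
    Small.{u} (Quot (CoendRel A B)) := by
  let S : ℕ → FintypeCat.{u} := fun n => FintypeCat.of (ULift.{u} (Fin n))
  refine small_of_surjective (α := Σ n : ℕ, A.obj (S n) × B.obj (op (S n)))
    (f := fun p => Quot.mk _ ⟨S p.1, p.2⟩) ?_
  rintro ⟨W, a, b⟩
  obtain ⟨n, ⟨e⟩⟩ := Finite.exists_equiv_fin W.obj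
  let i : W ≅ S n := FintypeCat.equivEquivIso (e.trans Equiv.ulift.symm)
  refine ⟨⟨n, A.map i.hom a, B.map i.inv.op b⟩, ?_⟩
  have h := CoendRel.glue (A := A) (B := B) i.hom a (B.map i.inv.op b)
  have h2 : B.map i.hom.op (B.map i.inv.op b) = b := by
    rw [← Functor.map_comp_apply, ← op_comp, i.hom_inv_id, op_id, Functor.map_id_apply]
  rw [h2] at h
  exact (Quot.sound h).symm

/-- The coend `∫^W A W × B W` over finite sets `W`, as a set in the universe of `A` and `B`. -/
def coend (A : FintypeCat.{u} ⥤ Type u) (B : FintypeCat.{u}ᵒᵖ ⥤ Type u) : Type u :=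
  Shrink.{u} (Quot (CoendRel A B))

namespace coend

variable {A : FintypeCat.{u} ⥤ Type u} {B : FintypeCat.{u}ᵒᵖ ⥤ Type u}

/-- The coend injections. -/
def ι (W : FintypeCat.{u}) (a : A.obj W) (b : B.obj (op W)) : coend A B :=
  equivShrink _ (Quot.mk _ ⟨W, (a, b)⟩)

theorem ι_glue {W W' : FintypeCat.{u}} (f : W ⟶ W') (a : A.obj W) (b : B.obj (op W')) :
    (ι W a (B.map f.op b) : coend A B) = ι W' (A.map f a) b :=
  congrArg _ (Quot.sound (CoendRel.glue f a b))

theorem ind {p : coend A B → Prop} (h : ∀ W a b, p (ι W a b)) (x : coend A B) : p x := by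
  obtain ⟨y, rfl⟩ := (equivShrink _).surjective x
  obtain ⟨W, a, b⟩ := y
  exact h W a b

/-- The universal property of the coend. -/
def desc {S : Type u} (φ : ∀ W : FintypeCat.{u}, A.obj W → B.obj (op W) → S)
    (h : ∀ (W W' : FintypeCat.{u}) (f : W ⟶ W') (a : A.obj W) (b : B.obj (op W')),
      φ W a (B.map f.op b) = φ W' (A.map f a) b) (x : coend A B) : S :=
  Quot.lift (fun p => φ p.1 p.2.1 p.2.2) (by rintro _ _ ⟨f, a, b⟩; exact h _ _ f a b)
    ((equivShrink _).symm x)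

@[simp]
theorem desc_ι {S : Type u} (φ : ∀ W : FintypeCat.{u}, A.obj W → B.obj (op W) → S)
    (h : ∀ (W W' : FintypeCat.{u}) (f : W ⟶ W') (a : A.obj W) (b : B.obj (op W')),
      φ W a (B.map f.op b) = φ W' (A.map f a) b) (W : FintypeCat.{u}) (a : A.obj W)
    (b : B.obj (op W)) : desc φ h (ι W a b) = φ W a b := by
  simp [desc, ι]

/-- Equality of elements of a coend, in terms of the generating relation. -/
theorem exact {W W' : FintypeCat.{u}} {a : A.obj W} {b : B.obj (op W)} {a' : A.obj W'}
    {b' : B.obj (op W')} (h : (ι W a b : coend A B) = ι W' a' b') :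
    Relation.EqvGen (CoendRel A B) ⟨W, (a, b)⟩ ⟨W', (a', b')⟩ :=
  Quot.eqvGen_exact ((equivShrink _).injective h)

end coend

/-! ### Finitary functors and the substitution tensor product -/

/-- A finitary functor, that is, a functor `𝔽 ⥤ 𝕊` from finite sets to sets. (This is a wrapper of
Mathlib's functor category, which carries the substitution monoidal structure below instead of the
pointwise one.) -/
structure FinFunctor : Type (u + 1) where
  /-- The underlying functor. -/
  toFunctor : FintypeCat.{u} ⥤ Type u

namespace FinFunctor

/-- The action on objects. -/
abbrev obj (F : FinFunctor.{u}) (X : FintypeCat.{u}) : Type u := F.toFunctor.obj X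

/-- The action on morphisms, as a function. -/
def map (F : FinFunctor.{u}) {X Y : FintypeCat.{u}} (f : X ⟶ Y) (a : F.obj X) : F.obj Y :=
  F.toFunctor.map f a

@[simp]
theorem map_id (F : FinFunctor.{u}) {X : FintypeCat.{u}} (a : F.obj X) : F.map (𝟙 X) a = a :=
  F.toFunctor.map_id_apply X a

@[simp]
theorem map_comp (F : FinFunctor.{u}) {X Y Z : FintypeCat.{u}} (f : X ⟶ Y) (g : Y ⟶ Z)
    (a : F.obj X) : F.map (f ≫ g) a = F.map g (F.map f a) :=
  F.toFunctor.map_comp_apply f g a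

/-- A morphism of finitary functors is a natural transformation. -/
@[ext]
structure Hom (F G : FinFunctor.{u}) : Type (u + 1) where
  /-- The underlying natural transformation. -/
  toNatTrans : F.toFunctor ⟶ G.toFunctor

/-- The category `[𝔽, 𝕊]` of finitary functors. -/
instance : Category FinFunctor.{u} where
  Hom := Hom
  id F := ⟨𝟙 F.toFunctor⟩
  comp σ τ := ⟨σ.toNatTrans ≫ τ.toNatTrans⟩

/-- The components of a morphism, as functions. -/
def Hom.app {F G : FinFunctor.{u}} (τ : F ⟶ G) (X : FintypeCat.{u}) (a : F.obj X) : G.obj X :=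
  τ.toNatTrans.app X a

@[ext]
theorem hom_ext {F G : FinFunctor.{u}} {σ τ : F ⟶ G}
    (h : ∀ (X : FintypeCat.{u}) (a : F.obj X), Hom.app σ X a = Hom.app τ X a) : σ = τ := by
  apply Hom.ext
  ext X a
  exact h X a

theorem naturality {F G : FinFunctor.{u}} (τ : F ⟶ G) {X Y : FintypeCat.{u}} (f : X ⟶ Y)
    (a : F.obj X) : Hom.app τ Y (F.map f a) = G.map f (Hom.app τ X a) :=
  NatTrans.naturality_apply τ.toNatTrans f a

@[simp]
theorem comp_app {F G H : FinFunctor.{u}} (σ : F ⟶ G) (τ : G ⟶ H) (X : FintypeCat.{u})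
    (a : F.obj X) : Hom.app (σ ≫ τ) X a = Hom.app τ X (Hom.app σ X a) := rfl

@[simp]
theorem id_app (F : FinFunctor.{u}) (X : FintypeCat.{u}) (a : F.obj X) :
    Hom.app (𝟙 F) X a = a := rfl

/-- Constructor for morphisms. -/
def homMk {F G : FinFunctor.{u}} (φ : ∀ X : FintypeCat.{u}, F.obj X → G.obj X)
    (h : ∀ (X Y : FintypeCat.{u}) (f : X ⟶ Y) (a : F.obj X),
      φ Y (F.map f a) = G.map f (φ X a)) : F ⟶ G where
  toNatTrans := { app := fun X => ↾(φ X), naturality := by intro X Y f; ext a; exact h X Y f a }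

@[simp]
theorem homMk_app {F G : FinFunctor.{u}} (φ : ∀ X : FintypeCat.{u}, F.obj X → G.obj X)
    (h : ∀ (X Y : FintypeCat.{u}) (f : X ⟶ Y) (a : F.obj X),
      φ Y (F.map f a) = G.map f (φ X a)) (X : FintypeCat.{u}) (a : F.obj X) :
    Hom.app (homMk φ h) X a = φ X a := rfl

/-- A morphism with bijective components is an isomorphism. -/
def isoMk {F G : FinFunctor.{u}} (τ : F ⟶ G)
    (h : ∀ X : FintypeCat.{u}, Function.Bijective (Hom.app τ X)) : F ≅ G where
  hom := τ
  inv := homMk (fun X => (Equiv.ofBijective _ (h X)).symm) (by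
    intro X Y f a
    rw [Equiv.symm_apply_eq, Equiv.ofBijective_apply, naturality]
    exact congrArg _ ((Equiv.ofBijective _ (h X)).apply_symm_apply a).symm)
  hom_inv_id := by
    ext X a
    exact (Equiv.ofBijective _ (h X)).symm_apply_apply a
  inv_hom_id := by
    ext X a
    exact (Equiv.ofBijective _ (h X)).apply_symm_apply a

@[simp]
theorem isoMk_hom {F G : FinFunctor.{u}} (τ : F ⟶ G)
    (h : ∀ X : FintypeCat.{u}, Function.Bijective (Hom.app τ X)) : (isoMk τ h).hom = τ := rfl

/-- The inclusion functor `i` of finite sets into sets. -/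
abbrev incl : FinFunctor.{u} where
  toFunctor :=
    { obj := fun X => X.obj
      map := fun f => f.hom }

@[simp]
theorem incl_map {X Y : FintypeCat.{u}} (f : X ⟶ Y) (x : X) : incl.map f x = f x := rfl

/-- The contravariant functor `C ↦ (C → S)`. -/
def pow (S : Type u) : FintypeCat.{u}ᵒᵖ ⥤ Type u where
  obj C := C.unop.obj → S
  map f := ↾fun k c => k (f.unop c)

/-- The value `∫^C F C × (C → S)`; for `S = G X` it is the substitution product `(F ∘ G)(X)`. -/
def Ext (F : FinFunctor.{u}) (S : Type u) : Type u := coend F.toFunctor (pow S)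

namespace Ext

variable {F : FinFunctor.{u}} {S : Type u}

/-- The element of `∫^C F C × (C → S)` represented by `a ∈ F C` and `k : C → S`. -/
def mk (C : FintypeCat.{u}) (a : F.obj C) (k : C → S) : F.Ext S :=
  coend.ι (B := pow S) C a k

theorem glue {C D : FintypeCat.{u}} (f : C ⟶ D) (a : F.obj C) (k : D → S) :
    (mk C a (fun c => k (f c)) : F.Ext S) = mk D (F.map f a) k :=
  coend.ι_glue (B := pow S) f a k

@[elab_as_elim]
theorem ind {p : F.Ext S → Prop} (h : ∀ C a k, p (mk C a k)) (x : F.Ext S) : p x :=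
  coend.ind h x

/-- The universal property. -/
def desc {T : Type u} (φ : ∀ C : FintypeCat.{u}, F.obj C → (C → S) → T)
    (h : ∀ (C D : FintypeCat.{u}) (f : C ⟶ D) (a : F.obj C) (k : D → S),
      φ C a (fun c => k (f c)) = φ D (F.map f a) k) : F.Ext S → T :=
  coend.desc (B := pow S) φ h

@[simp]
theorem desc_mk {T : Type u} (φ : ∀ C : FintypeCat.{u}, F.obj C → (C → S) → T)
    (h : ∀ (C D : FintypeCat.{u}) (f : C ⟶ D) (a : F.obj C) (k : D → S),
      φ C a (fun c => k (f c)) = φ D (F.map f a) k) (C : FintypeCat.{u}) (a : F.obj C)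
    (k : C → S) : desc φ h (mk C a k) = φ C a k :=
  coend.desc_ι (B := pow S) φ h C a k

/-- Functoriality in the set `S`. -/
def postcomp {T : Type u} (φ : S → T) : F.Ext S → F.Ext T :=
  desc (fun C a k => mk C a fun c => φ (k c)) fun _ _ f a k => glue f a fun d => φ (k d)

@[simp]
theorem postcomp_mk {T : Type u} (φ : S → T) (C : FintypeCat.{u}) (a : F.obj C) (k : C → S) :
    postcomp φ (mk C a k) = mk C a fun c => φ (k c) :=
  desc_mk _ _ _ _ _

end Ext

/-- The substitution tensor product `(F ∘ G)(X) = ∫^C F C × (C → G X)`. -/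
def subst (F G : FinFunctor.{u}) : FinFunctor.{u} where
  toFunctor :=
    { obj := fun X => F.Ext (G.obj X)
      map := fun f => ↾Ext.postcomp (G.map f)
      map_id := by
        intro X
        ext x
        induction x using Ext.ind with | _ C a k
        simp
      map_comp := by
        intro X Y Z f g
        ext x
        induction x using Ext.ind with | _ C a k
        simp }

/-- The element of `(F ∘ G)(X)` represented by `a ∈ F C` and `k : C → G X`. -/
def mk' {F G : FinFunctor.{u}} {X : FintypeCat.{u}} (C : FintypeCat.{u}) (a : F.obj C)
    (k : C → G.obj X) : (subst F G).obj X :=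
  Ext.mk C a k

theorem glue {F G : FinFunctor.{u}} {X C D : FintypeCat.{u}} (f : C ⟶ D) (a : F.obj C)
    (k : D → G.obj X) :
    (mk' C a (fun c => k (f c)) : (subst F G).obj X) = mk' D (F.map f a) k :=
  Ext.glue f a k

@[elab_as_elim]
theorem ind {F G : FinFunctor.{u}} {X : FintypeCat.{u}} {p : (subst F G).obj X → Prop}
    (h : ∀ C a k, p (mk' C a k)) (x : (subst F G).obj X) : p x :=
  Ext.ind h x

/-- The universal property of the coend defining `(F ∘ G)(X)`. -/
def desc {F G : FinFunctor.{u}} {X : FintypeCat.{u}} {T : Type u}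
    (φ : ∀ C : FintypeCat.{u}, F.obj C → (C → G.obj X) → T)
    (h : ∀ (C D : FintypeCat.{u}) (f : C ⟶ D) (a : F.obj C) (k : D → G.obj X),
      φ C a (fun c => k (f c)) = φ D (F.map f a) k) : (subst F G).obj X → T :=
  Ext.desc φ h

@[simp]
theorem desc_mk' {F G : FinFunctor.{u}} {X : FintypeCat.{u}} {T : Type u}
    (φ : ∀ C : FintypeCat.{u}, F.obj C → (C → G.obj X) → T)
    (h : ∀ (C D : FintypeCat.{u}) (f : C ⟶ D) (a : F.obj C) (k : D → G.obj X),
      φ C a (fun c => k (f c)) = φ D (F.map f a) k) (C : FintypeCat.{u}) (a : F.obj C)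
    (k : C → G.obj X) : desc φ h (mk' C a k) = φ C a k :=
  Ext.desc_mk φ h C a k

@[simp]
theorem subst_map {F G : FinFunctor.{u}} {X Y : FintypeCat.{u}} (f : X ⟶ Y) (C : FintypeCat.{u})
    (a : F.obj C) (k : C → G.obj X) :
    (subst F G).map f (mk' C a k) = mk' C a fun c => G.map f (k c) :=
  Ext.postcomp_mk (G.map f) C a k

/-- The action `σ ∘ τ : F ∘ G ⟶ F' ∘ G'` of the tensor product on morphisms. -/
def substMap {F F' G G' : FinFunctor.{u}} (σ : F ⟶ F') (τ : G ⟶ G') : subst F G ⟶ subst F' G' :=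
  homMk (fun X => desc (fun C a k => mk' C (Hom.app σ C a) fun c => Hom.app τ X (k c))
    (by
      intro C D f a k
      rw [naturality]
      exact glue f _ fun d => Hom.app τ X (k d)))
    (by
      intro X Y f x
      induction x using ind with | _ C a k
      simp [naturality])

@[simp]
theorem substMap_mk {F F' G G' : FinFunctor.{u}} (σ : F ⟶ F') (τ : G ⟶ G') {X : FintypeCat.{u}}
    (C : FintypeCat.{u}) (a : F.obj C) (k : C → G.obj X) :
    Hom.app (substMap σ τ) X (mk' C a k) =
      mk' C (Hom.app σ C a) fun c => Hom.app τ X (k c) := by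
  simp [substMap]

/-- The components of the left unitor. -/
def leftUnitorApp (F : FinFunctor.{u}) (X : FintypeCat.{u}) : (subst incl F).obj X → F.obj X :=
  desc (F := incl) (G := F) (fun _ c k => k c) (fun _ _ _ _ _ => rfl)

@[simp]
theorem leftUnitorApp_mk (F : FinFunctor.{u}) {X : FintypeCat.{u}} (C : FintypeCat.{u})
    (c : incl.obj C) (k : C → F.obj X) : leftUnitorApp F X (mk' C c k) = k c :=
  desc_mk' (F := incl) (G := F) (fun _ c k => k c) (fun _ _ _ _ _ => rfl) C c k

/-- The left unitor `i ∘ F ⟶ F`. -/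
def leftUnitorHom (F : FinFunctor.{u}) : subst incl F ⟶ F :=
  homMk (leftUnitorApp F)
    (by
      intro X Y f x
      induction x using ind with | _ C c k
      simp)

@[simp]
theorem leftUnitorHom_mk (F : FinFunctor.{u}) {X : FintypeCat.{u}} (C : FintypeCat.{u})
    (c : incl.obj C) (k : C → F.obj X) :
    Hom.app (leftUnitorHom F) X (mk' C c k) = k c := by
  simp [leftUnitorHom]

theorem leftUnitorHom_bijective (F : FinFunctor.{u}) (X : FintypeCat.{u}) :
    Function.Bijective (Hom.app (leftUnitorHom F) X) := by
  have key : ∀ x : (subst incl F).obj X,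
      x = mk' (F := incl) fone PUnit.unit fun _ => Hom.app (leftUnitorHom F) X x := by
    intro x
    induction x using ind with | _ C c k
    rw [leftUnitorHom_mk]
    exact (glue (F := incl) (G := F) (fpoint (X := C) c) PUnit.unit k).symm
  refine ⟨fun x y h => ?_, fun a => ⟨mk' (F := incl) fone PUnit.unit fun _ => a, ?_⟩⟩
  · rw [key x, key y, h]
  · rw [leftUnitorHom_mk]

/-- The right unitor `F ∘ i ⟶ F`. -/
def rightUnitorHom (F : FinFunctor.{u}) : subst F incl ⟶ F :=
  homMk (fun X => desc (fun C a (k : C → X) => F.map (FintypeCat.homMk k) a)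
    (by
      intro C D f a k
      rw [← map_comp]
      rfl))
    (by
      intro X Y f x
      induction x using ind with | _ C a k
      rw [subst_map, desc_mk', desc_mk', ← map_comp]
      rfl)

@[simp]
theorem rightUnitorHom_mk (F : FinFunctor.{u}) {X : FintypeCat.{u}} (C : FintypeCat.{u})
    (a : F.obj C) (k : C → incl.obj X) :
    Hom.app (rightUnitorHom F) X (mk' C a k) =
      F.map (FintypeCat.homMk (X := C) (Y := X) k) a := by
  simp [rightUnitorHom]

theorem rightUnitorHom_bijective (F : FinFunctor.{u}) (X : FintypeCat.{u}) :
    Function.Bijective (Hom.app (rightUnitorHom F) X) := by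
  have key : ∀ x : (subst F incl).obj X,
      x = mk' (G := incl) X (Hom.app (rightUnitorHom F) X x) fun y => y := by
    intro x
    induction x using ind with | _ C a k
    rw [rightUnitorHom_mk]
    exact glue (F := F) (G := incl) (X := X) (FintypeCat.homMk k) a fun y => y
  refine ⟨fun x y h => ?_, fun a => ⟨mk' (G := incl) X a fun y => y, ?_⟩⟩
  · rw [key x, key y, h]
  · rw [rightUnitorHom_mk]
    exact F.map_id a

/-- The associator `(F ∘ G) ∘ H ⟶ F ∘ (G ∘ H)`. -/
def associatorHom (F G H : FinFunctor.{u}) : subst (subst F G) H ⟶ subst F (subst G H) :=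
  homMk (fun X => desc (fun D x h => desc (fun C a g => mk' C a fun c => mk' D (g c) h)
      (by
        intro C C' f a k
        exact glue (G := subst G H) f a fun c => mk' D (k c) h) x)
    (by
      intro D D' f x h
      induction x using ind with | _ C a g
      simp [glue]))
    (by
      intro X Y f x
      induction x using ind with | _ D x h
      induction x using ind with | _ C a g
      simp)

@[simp]
theorem associatorHom_mk (F G H : FinFunctor.{u}) {X : FintypeCat.{u}} (D C : FintypeCat.{u})
    (a : F.obj C) (g : C → G.obj D) (h : D → H.obj X) :
    Hom.app (associatorHom F G H) X (mk' D (mk' (F := F) (G := G) C a g) h) =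
      mk' C a fun c => mk' D (g c) h := by
  simp [associatorHom]

/-- The map from `C` to a subset containing the values of `k`. -/
def toSubset {S : Type u} (T : Set S) [Finite T] {C : FintypeCat.{u}} (k : C → S)
    (hk : ∀ c, k c ∈ T) : C ⟶ FintypeCat.of T :=
  FintypeCat.homMk fun c => ⟨k c, hk c⟩

theorem Ext.mk_toSubset {F : FinFunctor.{u}} {S : Type u} (T : Set S) [Finite T]
    {C : FintypeCat.{u}} (a : F.obj C) (k : C → S) (hk : ∀ c, k c ∈ T) :
    Ext.mk (F := F) C a k =
      Ext.mk (FintypeCat.of T) (F.map (toSubset T k hk) a) Subtype.val :=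
  Ext.glue (toSubset T k hk) a Subtype.val

theorem map_toSubset_mono (F : FinFunctor.{u}) {S : Type u} {C : FintypeCat.{u}} (a : F.obj C)
    (k : C → S) (T T' : Set S) [Finite T] [Finite T'] (hk : ∀ c, k c ∈ T) (hT : T ⊆ T') :
    F.map (toSubset T' k fun c => hT (hk c)) a =
      F.map (toSubset T' (C := FintypeCat.of T) Subtype.val fun t => hT t.2)
        (F.map (toSubset T k hk) a) := by
  rw [← map_comp]
  rfl

/-- Two pairs represent the same element of `∫^C F C × (C → S)` only if they agree over some
finite subset of `S`. -/
theorem Ext.exact {F : FinFunctor.{u}} {S : Type u} {C D : FintypeCat.{u}} {a : F.obj C}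
    {k : C → S} {b : F.obj D} {l : D → S} (h : Ext.mk (F := F) C a k = Ext.mk D b l) :
    ∃ (T : Set S) (_ : Finite T) (hk : ∀ c, k c ∈ T) (hl : ∀ d, l d ∈ T),
      F.map (toSubset T k hk) a = F.map (toSubset T l hl) b := by
  let R : (Σ W : FintypeCat.{u}, F.obj W × (W → S)) →
      (Σ W : FintypeCat.{u}, F.obj W × (W → S)) → Prop := fun p q =>
    ∃ (T : Set S) (_ : Finite T) (hk : ∀ c, p.2.2 c ∈ T) (hl : ∀ d, q.2.2 d ∈ T),
      F.map (toSubset T p.2.2 hk) p.2.1 = F.map (toSubset T q.2.2 hl) q.2.1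
  have main : ∀ p q, Relation.EqvGen (CoendRel F.toFunctor (pow S)) p q → R p q := by
    intro p q h
    induction h with
    | rel p q h =>
      obtain ⟨f, a, b⟩ := h
      have : Finite (Set.range b) := Set.finite_range (ι := ↑(_ : FintypeCat.{u})) b
      refine ⟨Set.range b, this, fun c => ⟨_, rfl⟩, fun d => ⟨d, rfl⟩, ?_⟩
      exact (F.map_comp f (toSubset (Set.range b) b fun d => ⟨d, rfl⟩) a)
    | refl p => exact ⟨Set.range p.2.2, Set.finite_range (ι := ↑p.1) p.2.2,
        fun c => ⟨_, rfl⟩, fun d => ⟨d, rfl⟩, rfl⟩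
    | symm p q _ ih =>
      obtain ⟨T, hT, hk, hl, e⟩ := ih
      exact ⟨T, hT, hl, hk, e.symm⟩
    | trans p q r _ _ ih₁ ih₂ =>
      obtain ⟨T, hT, hk, hl, e⟩ := ih₁
      obtain ⟨T', hT', hk', hl', e'⟩ := ih₂
      refine ⟨T ∪ T', inferInstance, fun c => Or.inl (hk c), fun d => Or.inr (hl' d), ?_⟩
      rw [map_toSubset_mono F p.2.1 p.2.2 T (T ∪ T') hk Set.subset_union_left, e,
        ← map_toSubset_mono F q.2.1 q.2.2 T (T ∪ T') hl Set.subset_union_left,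
        map_toSubset_mono F q.2.1 q.2.2 T' (T ∪ T') hk' Set.subset_union_right, e',
        ← map_toSubset_mono F r.2.1 r.2.2 T' (T ∪ T') hl' Set.subset_union_right]
  exact main _ _ (coend.exact (B := pow S) h)

theorem associatorHom_bijective (F G H : FinFunctor.{u}) (X : FintypeCat.{u}) :
    Function.Bijective (Hom.app (associatorHom F G H) X) := by
  constructor
  · intro x y hxy
    induction x using ind with | _ D x h
    induction x using ind with | _ C a g
    induction y using ind with | _ D' y h'
    induction y using ind with | _ C' a' g'
    rw [associatorHom_mk, associatorHom_mk] at hxy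
    obtain ⟨T, hT, hk, hl, e⟩ := Ext.exact hxy
    have hrep : ∀ t : (subst G H).obj X, ∃ (E : FintypeCat.{u}) (w : G.obj E) (l : E → H.obj X),
        t = mk' (F := G) (G := H) E w l := by
      intro t
      induction t using ind with | _ E w l
      exact ⟨E, w, l, rfl⟩
    choose E w l hE using hrep
    have h₁ := fun c => Ext.exact (F := G) (hE (mk' D (g c) h))
    have h₂ := fun c => Ext.exact (F := G) (hE (mk' D' (g' c) h'))
    choose U₁ hU₁ ha₁ hb₁ e₁ using h₁
    choose U₂ hU₂ ha₂ hb₂ e₂ using h₂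
    have hr : ∀ t : T, Finite (Set.range (l t.1)) := fun t =>
      Set.finite_range (ι := (E t.1).obj) (l t.1)
    let U : Set (H.obj X) := ((⋃ c, U₁ c) ∪ ⋃ c, U₂ c) ∪
      ((⋃ t : T, Set.range (l t.1)) ∪ (Set.range h ∪ Set.range h'))
    have : Finite (Set.range h) := Set.finite_range (ι := D.obj) h
    have : Finite (Set.range h') := Set.finite_range (ι := D'.obj) h'
    have : Finite U := inferInstance
    have i₁ : ∀ c, U₁ c ⊆ U := fun c x hx => Or.inl (Or.inl (Set.mem_iUnion.2 ⟨c, hx⟩))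
    have i₂ : ∀ c, U₂ c ⊆ U := fun c x hx => Or.inl (Or.inr (Set.mem_iUnion.2 ⟨c, hx⟩))
    have il : ∀ (t : T) d, l t.1 d ∈ U := fun t d => Or.inr (Or.inl (Set.mem_iUnion.2 ⟨t, d, rfl⟩))
    have ih : ∀ d, h d ∈ U := fun d => Or.inr (Or.inr (Or.inl ⟨d, rfl⟩))
    have ih' : ∀ d, h' d ∈ U := fun d => Or.inr (Or.inr (Or.inr ⟨d, rfl⟩))
    let v : T → G.obj (FintypeCat.of U) := fun t => G.map (toSubset U (l t.1) (il t)) (w t.1)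
    have f₁ : ∀ c, G.map (toSubset U h ih) (g c) = v ⟨_, hk c⟩ := by
      intro c
      have q := congrArg (G.map (toSubset U (C := FintypeCat.of (U₁ c)) Subtype.val
        fun t => i₁ c t.2)) (e₁ c)
      rw [← map_toSubset_mono, ← map_toSubset_mono] at q
      exact q
    have f₂ : ∀ c, G.map (toSubset U h' ih') (g' c) = v ⟨_, hl c⟩ := by
      intro c
      have q := congrArg (G.map (toSubset U (C := FintypeCat.of (U₂ c)) Subtype.val
        fun t => i₂ c t.2)) (e₂ c)
      rw [← map_toSubset_mono, ← map_toSubset_mono] at q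
      exact q
    have g₁ := Ext.mk_toSubset (F := subst F G) U (mk' (F := F) (G := G) C a g) h ih
    have g₂ := Ext.mk_toSubset (F := subst F G) U (mk' (F := F) (G := G) C' a' g') h' ih'
    rw [subst_map] at g₁ g₂
    refine g₁.trans (Eq.trans ?_ g₂.symm)
    have k₁ := glue (F := F) (G := G) (X := FintypeCat.of U) (toSubset T _ hk) a v
    have k₂ := glue (F := F) (G := G) (X := FintypeCat.of U) (toSubset T _ hl) a' v
    rw [← e] at k₂
    congr 1
    refine Eq.trans ?_ (k₁.trans (k₂.symm.trans ?_))
    · congr 1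
      funext c
      exact f₁ c
    · congr 1
      funext c
      exact (f₂ c).symm
  · intro y
    induction y using ind with | _ C a k
    have hk : ∀ c : C, ∃ (D : FintypeCat.{u}) (g : G.obj D) (h : D → H.obj X),
        k c = mk' (F := G) (G := H) D g h := by
      intro c
      induction k c using ind with | _ D g h
      exact ⟨D, g, h, rfl⟩
    choose D g h hgh using hk
    refine ⟨mk' (FintypeCat.of (Σ c : C, D c)) (mk' (F := F) (G := G) C a fun c =>
      G.map (FintypeCat.homMk fun d => ⟨c, d⟩) (g c)) fun p => h p.1 p.2, ?_⟩
    rw [associatorHom_mk]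
    congr 1
    funext c
    rw [hgh c]
    exact (glue (F := G) (G := H) (D := FintypeCat.of (Σ c : C, D c))
      (FintypeCat.homMk fun d => ⟨c, d⟩) (g c) fun p => h p.1 p.2).symm

/-- The substitution monoidal structure `[𝔽, 𝕊]_∘` on finitary functors. -/
instance : MonoidalCategory FinFunctor.{u} where
  tensorObj := subst
  tensorUnit := incl
  tensorHom := substMap
  whiskerLeft F _ _ τ := substMap (𝟙 F) τ
  whiskerRight σ G := substMap σ (𝟙 G)
  associator F G H := isoMk (associatorHom F G H) (associatorHom_bijective F G H)
  leftUnitor F := isoMk (leftUnitorHom F) (leftUnitorHom_bijective F)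
  rightUnitor F := isoMk (rightUnitorHom F) (rightUnitorHom_bijective F)
  tensorHom_def σ τ := by
    ext X x
    induction x using ind with | _ C a k
    simp
  id_tensorHom_id F G := by
    ext X x
    induction x using ind with | _ C a k
    simp
  tensorHom_comp_tensorHom _ _ _ _ := by
    ext X x
    induction x using ind with | _ C a k
    simp
  whiskerLeft_id F G := by
    ext X x
    induction x using ind with | _ C a k
    simp
  id_whiskerRight F G := by
    ext X x
    induction x using ind with | _ C a k
    simp
  associator_naturality _ _ _ := by
    ext X x
    induction x using ind with | _ D x h
    induction x using ind with | _ C a k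
    simp
  leftUnitor_naturality τ := by
    ext X x
    induction x using ind with | _ C a k
    simp
  rightUnitor_naturality τ := by
    ext X x
    induction x using ind with | _ C a k
    simp [naturality]
  pentagon _ _ _ _ := by
    ext X x
    induction x using ind with | _ E x l
    induction x using ind with | _ D x h
    induction x using ind with | _ C a k
    simp
  triangle F G := by
    ext X x
    induction x using ind with | _ D x h
    induction x using ind with | _ C a k
    simp
    exact glue (F := F) (G := G) (FintypeCat.homMk k) a h

end FinFunctor

/-! ### Strong profunctors and their tensor product -/

/-- The action `P(f, g) : P(X, Y) → P(X', Y')` of an endoprofunctor on finite sets, as a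
function. -/
def dimap (P : FintypeCat.{u}ᵒᵖ × FintypeCat.{u} ⥤ Type u) {X X' Y Y' : FintypeCat.{u}}
    (f : X' ⟶ X) (g : Y ⟶ Y') (p : P.obj (op X, Y)) : P.obj (op X', Y') :=
  P.map (CategoryTheory.Prod.mkHom f.op g) p

/-- A (right) strong endoprofunctor on finite sets: a functor `P : 𝔽ᵒᵖ × 𝔽 ⥤ 𝕊` together with maps
`str : P(X, Y) → P(X × Z, Y × Z)`, natural in `X` and `Y` and dinatural in `Z`, which are compatible
with `1` and with products. -/
structure StrongProf : Type (u + 1) where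
  /-- The underlying endoprofunctor. -/
  toFunctor : FintypeCat.{u}ᵒᵖ × FintypeCat.{u} ⥤ Type u
  /-- The strength. -/
  str {X Y : FintypeCat.{u}} (Z : FintypeCat.{u}) (p : toFunctor.obj (op X, Y)) :
    toFunctor.obj (op (fprod X Z), fprod Y Z)
  str_natural {X X' Y Y' : FintypeCat.{u}} (Z : FintypeCat.{u}) (f : X' ⟶ X) (g : Y ⟶ Y')
    (p : toFunctor.obj (op X, Y)) :
    str Z (dimap toFunctor f g p) = dimap toFunctor (fmap₂ f (𝟙 Z)) (fmap₂ g (𝟙 Z)) (str Z p)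
  str_dinatural {X Y Z Z' : FintypeCat.{u}} (h : Z ⟶ Z') (p : toFunctor.obj (op X, Y)) :
    dimap toFunctor (fmap₂ (𝟙 X) h) (𝟙 _) (str Z' p) =
      dimap toFunctor (𝟙 _) (fmap₂ (𝟙 Y) h) (str Z p)
  str_one {X Y : FintypeCat.{u}} (p : toFunctor.obj (op X, Y)) :
    dimap toFunctor (𝟙 _) (fproj₁ Y fone) (str fone p) =
      dimap toFunctor (fproj₁ X fone) (𝟙 _) p
  str_str {X Y : FintypeCat.{u}} (V W : FintypeCat.{u}) (p : toFunctor.obj (op X, Y)) :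
    str W (str V p) =
      dimap toFunctor (fassocInv X V W) (fassoc Y V W) (str (fprod V W) p)

namespace StrongProf

/-- The value `P(X, Y)`. -/
abbrev obj (P : StrongProf.{u}) (X Y : FintypeCat.{u}) : Type u := P.toFunctor.obj (op X, Y)

/-- The action `P(f, g)`, as a function. -/
def map (P : StrongProf.{u}) {X X' Y Y' : FintypeCat.{u}} (f : X' ⟶ X) (g : Y ⟶ Y')
    (p : P.obj X Y) : P.obj X' Y' :=
  dimap P.toFunctor f g p

@[simp]
theorem map_id (P : StrongProf.{u}) {X Y : FintypeCat.{u}} (p : P.obj X Y) :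
    P.map (𝟙 X) (𝟙 Y) p = p :=
  P.toFunctor.map_id_apply _ p

@[simp]
theorem map_map (P : StrongProf.{u}) {X X' X'' Y Y' Y'' : FintypeCat.{u}} (f : X' ⟶ X)
    (g : Y ⟶ Y') (f' : X'' ⟶ X') (g' : Y' ⟶ Y'') (p : P.obj X Y) :
    P.map f' g' (P.map f g p) = P.map (f' ≫ f) (g ≫ g') p :=
  (P.toFunctor.map_comp_apply (CategoryTheory.Prod.mkHom f.op g) (CategoryTheory.Prod.mkHom f'.op g') p).symm

theorem str_map (P : StrongProf.{u}) {X X' Y Y' : FintypeCat.{u}} (Z : FintypeCat.{u})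
    (f : X' ⟶ X) (g : Y ⟶ Y') (p : P.obj X Y) :
    P.str Z (P.map f g p) = P.map (fmap₂ f (𝟙 Z)) (fmap₂ g (𝟙 Z)) (P.str Z p) :=
  P.str_natural Z f g p

theorem map_str (P : StrongProf.{u}) {X Y Z Z' : FintypeCat.{u}} (h : Z ⟶ Z') (p : P.obj X Y) :
    P.map (fmap₂ (𝟙 X) h) (𝟙 _) (P.str Z' p) = P.map (𝟙 _) (fmap₂ (𝟙 Y) h) (P.str Z p) :=
  P.str_dinatural h p

theorem map_str_one (P : StrongProf.{u}) {X Y : FintypeCat.{u}} (p : P.obj X Y) :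
    P.map (𝟙 _) (fproj₁ Y fone) (P.str fone p) = P.map (fproj₁ X fone) (𝟙 _) p :=
  P.str_one p

theorem str_comp (P : StrongProf.{u}) {X Y : FintypeCat.{u}} (V W : FintypeCat.{u})
    (p : P.obj X Y) :
    P.str W (P.str V p) = P.map (fassocInv X V W) (fassoc Y V W) (P.str (fprod V W) p) :=
  P.str_str V W p

/-- A strong natural transformation. -/
@[ext]
structure Hom (P Q : StrongProf.{u}) : Type (u + 1) where
  /-- The underlying natural transformation. -/
  toNatTrans : P.toFunctor ⟶ Q.toFunctor
  str {X Y : FintypeCat.{u}} (Z : FintypeCat.{u}) (p : P.obj X Y) :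
    toNatTrans.app (op (fprod X Z), fprod Y Z) (P.str Z p) =
      Q.str Z (toNatTrans.app (op X, Y) p)

/-- The category of strong endoprofunctors on finite sets. -/
instance : Category StrongProf.{u} where
  Hom := Hom
  id P := { toNatTrans := 𝟙 P.toFunctor, str := fun _ _ => rfl }
  comp σ τ :=
    { toNatTrans := σ.toNatTrans ≫ τ.toNatTrans
      str := fun Z p => by
        rw [NatTrans.comp_app_apply, NatTrans.comp_app_apply, σ.str, τ.str] }

/-- The components of a morphism, as functions. -/
def Hom.app {P Q : StrongProf.{u}} (τ : P ⟶ Q) (X Y : FintypeCat.{u}) (p : P.obj X Y) :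
    Q.obj X Y :=
  τ.toNatTrans.app (op X, Y) p

@[ext]
theorem hom_ext {P Q : StrongProf.{u}} {σ τ : P ⟶ Q}
    (h : ∀ (X Y : FintypeCat.{u}) (p : P.obj X Y), Hom.app σ X Y p = Hom.app τ X Y p) :
    σ = τ := by
  apply Hom.ext
  ext ⟨X, Y⟩ p
  exact h X.unop Y p

theorem naturality {P Q : StrongProf.{u}} (τ : P ⟶ Q) {X X' Y Y' : FintypeCat.{u}} (f : X' ⟶ X)
    (g : Y ⟶ Y') (p : P.obj X Y) :
    Hom.app τ X' Y' (P.map f g p) = Q.map f g (Hom.app τ X Y p) :=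
  NatTrans.naturality_apply τ.toNatTrans (CategoryTheory.Prod.mkHom f.op g) p

theorem app_str {P Q : StrongProf.{u}} (τ : P ⟶ Q) {X Y : FintypeCat.{u}} (Z : FintypeCat.{u})
    (p : P.obj X Y) :
    Hom.app τ (fprod X Z) (fprod Y Z) (P.str Z p) = Q.str Z (Hom.app τ X Y p) :=
  τ.str Z p

@[simp]
theorem comp_app {P Q R : StrongProf.{u}} (σ : P ⟶ Q) (τ : Q ⟶ R) (X Y : FintypeCat.{u})
    (p : P.obj X Y) : Hom.app (σ ≫ τ) X Y p = Hom.app τ X Y (Hom.app σ X Y p) := rfl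

@[simp]
theorem id_app (P : StrongProf.{u}) (X Y : FintypeCat.{u}) (p : P.obj X Y) :
    Hom.app (𝟙 P) X Y p = p := rfl

/-- Constructor for morphisms. -/
def homMk {P Q : StrongProf.{u}} (φ : ∀ X Y : FintypeCat.{u}, P.obj X Y → Q.obj X Y)
    (h : ∀ (X X' Y Y' : FintypeCat.{u}) (f : X' ⟶ X) (g : Y ⟶ Y') (p : P.obj X Y),
      φ X' Y' (P.map f g p) = Q.map f g (φ X Y p))
    (hstr : ∀ (X Y Z : FintypeCat.{u}) (p : P.obj X Y),
      φ (fprod X Z) (fprod Y Z) (P.str Z p) = Q.str Z (φ X Y p)) : P ⟶ Q where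
  toNatTrans :=
    { app := fun X => ↾(φ X.1.unop X.2)
      naturality := by
        intro X Y f
        ext p
        exact h _ _ _ _ f.1.unop f.2 p }
  str Z p := hstr _ _ Z p

@[simp]
theorem homMk_app {P Q : StrongProf.{u}} (φ : ∀ X Y : FintypeCat.{u}, P.obj X Y → Q.obj X Y)
    (h : ∀ (X X' Y Y' : FintypeCat.{u}) (f : X' ⟶ X) (g : Y ⟶ Y') (p : P.obj X Y),
      φ X' Y' (P.map f g p) = Q.map f g (φ X Y p))
    (hstr : ∀ (X Y Z : FintypeCat.{u}) (p : P.obj X Y),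
      φ (fprod X Z) (fprod Y Z) (P.str Z p) = Q.str Z (φ X Y p)) (X Y : FintypeCat.{u})
    (p : P.obj X Y) : Hom.app (homMk φ h hstr) X Y p = φ X Y p := rfl

/-- A morphism with bijective components is an isomorphism. -/
def isoMk {P Q : StrongProf.{u}} (τ : P ⟶ Q)
    (h : ∀ X Y : FintypeCat.{u}, Function.Bijective (Hom.app τ X Y)) : P ≅ Q where
  hom := τ
  inv := homMk (fun X Y => (Equiv.ofBijective _ (h X Y)).symm)
    (by
      intro X X' Y Y' f g p
      rw [Equiv.symm_apply_eq, Equiv.ofBijective_apply, naturality]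
      exact congrArg _ ((Equiv.ofBijective _ (h X Y)).apply_symm_apply p).symm)
    (by
      intro X Y Z p
      rw [Equiv.symm_apply_eq, Equiv.ofBijective_apply, app_str]
      exact congrArg _ ((Equiv.ofBijective _ (h X Y)).apply_symm_apply p).symm)
  hom_inv_id := by
    ext X Y p
    exact (Equiv.ofBijective _ (h X Y)).symm_apply_apply p
  inv_hom_id := by
    ext X Y p
    exact (Equiv.ofBijective _ (h X Y)).apply_symm_apply p

@[simp]
theorem isoMk_hom {P Q : StrongProf.{u}} (τ : P ⟶ Q)
    (h : ∀ X Y : FintypeCat.{u}, Function.Bijective (Hom.app τ X Y)) : (isoMk τ h).hom = τ := rfl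

/-- The hom-profunctor, with strength `f ↦ f × id`. -/
abbrev hom : StrongProf.{u} where
  toFunctor :=
    { obj := fun X => X.1.unop ⟶ X.2
      map := fun f => ↾fun p => f.1.unop ≫ p ≫ f.2 }
  str Z p := fmap₂ p (𝟙 Z)
  str_natural _ _ _ _ := rfl
  str_dinatural _ _ := rfl
  str_one _ := rfl
  str_str _ _ _ := rfl

@[simp]
theorem hom_map {X X' Y Y' : FintypeCat.{u}} (f : X' ⟶ X) (g : Y ⟶ Y') (p : hom.obj X Y) :
    hom.map f g p = f ≫ (p : X ⟶ Y) ≫ g := rfl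

/-- The covariant functor `P(X, -)`. -/
def left (P : StrongProf.{u}) (X : FintypeCat.{u}) : FintypeCat.{u} ⥤ Type u where
  obj W := P.obj X W
  map g := ↾fun p => P.map (𝟙 X) g p

/-- The contravariant functor `Q(-, Y)`. -/
def right (Q : StrongProf.{u}) (Y : FintypeCat.{u}) : FintypeCat.{u}ᵒᵖ ⥤ Type u where
  obj W := Q.obj W.unop Y
  map f := ↾fun q => Q.map f.unop (𝟙 Y) q

/-- The coend `∫^W P(X, W) × Q(W, Y)`. -/
def Comp (P Q : StrongProf.{u}) (X Y : FintypeCat.{u}) : Type u :=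
  coend (P.left X) (Q.right Y)

namespace Comp

variable {P Q : StrongProf.{u}} {X Y : FintypeCat.{u}}

/-- The element of `∫^W P(X, W) × Q(W, Y)` represented by `p ∈ P(X, W)` and `q ∈ Q(W, Y)`. -/
def mk (W : FintypeCat.{u}) (p : P.obj X W) (q : Q.obj W Y) : Comp P Q X Y :=
  coend.ι (A := P.left X) (B := Q.right Y) W p q

theorem glue {W W' : FintypeCat.{u}} (f : W ⟶ W') (p : P.obj X W) (q : Q.obj W' Y) :
    mk W p (Q.map f (𝟙 Y) q) = mk W' (P.map (𝟙 X) f p) q :=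
  coend.ι_glue (A := P.left X) (B := Q.right Y) f p q

@[elab_as_elim]
theorem ind {r : Comp P Q X Y → Prop} (h : ∀ W p q, r (mk W p q)) (x : Comp P Q X Y) : r x :=
  coend.ind h x

/-- The universal property. -/
def desc {T : Type u} (φ : ∀ W : FintypeCat.{u}, P.obj X W → Q.obj W Y → T)
    (h : ∀ (W W' : FintypeCat.{u}) (f : W ⟶ W') (p : P.obj X W) (q : Q.obj W' Y),
      φ W p (Q.map f (𝟙 Y) q) = φ W' (P.map (𝟙 X) f p) q) : Comp P Q X Y → T :=
  coend.desc (A := P.left X) (B := Q.right Y) φ h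

@[simp]
theorem desc_mk {T : Type u} (φ : ∀ W : FintypeCat.{u}, P.obj X W → Q.obj W Y → T)
    (h : ∀ (W W' : FintypeCat.{u}) (f : W ⟶ W') (p : P.obj X W) (q : Q.obj W' Y),
      φ W p (Q.map f (𝟙 Y) q) = φ W' (P.map (𝟙 X) f p) q) (W : FintypeCat.{u})
    (p : P.obj X W) (q : Q.obj W Y) : desc φ h (mk W p q) = φ W p q :=
  coend.desc_ι (A := P.left X) (B := Q.right Y) φ h W p q

/-- The action of `P ⊗ Q` on morphisms. -/
def map {X' Y' : FintypeCat.{u}} (f : X' ⟶ X) (g : Y ⟶ Y') : Comp P Q X Y → Comp P Q X' Y' :=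
  desc (fun W p q => mk W (P.map f (𝟙 W) p) (Q.map (𝟙 W) g q)) (by
    intro W W' h p q
    have := glue h (P.map f (𝟙 W) p) (Q.map (𝟙 W') g q)
    simpa using this)

@[simp]
theorem map_mk {X' Y' : FintypeCat.{u}} (f : X' ⟶ X) (g : Y ⟶ Y') (W : FintypeCat.{u})
    (p : P.obj X W) (q : Q.obj W Y) :
    map f g (mk W p q) = mk W (P.map f (𝟙 W) p) (Q.map (𝟙 W) g q) :=
  desc_mk _ _ _ _ _

/-- The strength of `P ⊗ Q`. -/
def str (Z : FintypeCat.{u}) : Comp P Q X Y → Comp P Q (fprod X Z) (fprod Y Z) :=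
  desc (fun W p q => mk (fprod W Z) (P.str Z p) (Q.str Z q)) (by
    intro W W' h p q
    rw [str_map, str_map]
    exact glue (fmap₂ h (𝟙 Z)) (P.str Z p) (Q.str Z q))

@[simp]
theorem str_mk (Z W : FintypeCat.{u}) (p : P.obj X W) (q : Q.obj W Y) :
    str Z (mk W p q) = mk (fprod W Z) (P.str Z p) (Q.str Z q) :=
  desc_mk _ _ _ _ _

theorem str_map {X' Y' : FintypeCat.{u}} (Z : FintypeCat.{u}) (f : X' ⟶ X) (g : Y ⟶ Y')
    (x : Comp P Q X Y) :
    str Z (map f g x) = map (fmap₂ f (𝟙 Z)) (fmap₂ g (𝟙 Z)) (str Z x) := by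
  induction x using Comp.ind with | _ W p q
  simp [StrongProf.str_map]

theorem map_str {Z Z' : FintypeCat.{u}} (h : Z ⟶ Z') (x : Comp P Q X Y) :
    map (fmap₂ (𝟙 X) h) (𝟙 _) (str Z' x) = map (𝟙 _) (fmap₂ (𝟙 Y) h) (str Z x) := by
  induction x using Comp.ind with | _ W p q
  have e := Comp.glue (fmap₂ (𝟙 W) h) (P.str _ p) (Q.str _ q)
  rw [← P.map_str h p, Q.map_str h q] at e
  simp [e]

theorem map_str_one (x : Comp P Q X Y) :
    map (𝟙 _) (fproj₁ Y fone) (str fone x) = map (fproj₁ X fone) (𝟙 _) x := by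
  induction x using Comp.ind with | _ W p q
  have e := Comp.glue (fproj₁ W fone) (P.str _ p) q
  rw [← Q.map_str_one q, P.map_str_one p] at e
  simp [e]

theorem str_str (V W : FintypeCat.{u}) (x : Comp P Q X Y) :
    str W (str V x) = map (fassocInv X V W) (fassoc Y V W) (str (fprod V W) x) := by
  induction x using Comp.ind with | _ W' p q
  have e := Comp.glue (fassoc W' V W)
    (P.map (fassocInv X V W) (𝟙 (fprod W' (fprod V W))) (P.str (fprod V W) p))
    (Q.str W (Q.str V q))
  simp only [StrongProf.map_map, Category.comp_id, Category.id_comp, str_comp,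
    fassoc_fassocInv] at e
  simp [str_comp, e]

end Comp

/-- The underlying profunctor of `P ⊗ Q`. -/
def tensorFunctor (P Q : StrongProf.{u}) : FintypeCat.{u}ᵒᵖ × FintypeCat.{u} ⥤ Type u where
  obj X := Comp P Q X.1.unop X.2
  map f := ↾Comp.map f.1.unop f.2
  map_id X := by
    ext x
    induction x using Comp.ind with | _ W p q
    simp
  map_comp f g := by
    ext x
    induction x using Comp.ind with | _ W p q
    simp

/-- The tensor product `(P ⊗ Q)(X, Y) = ∫^W P(X, W) × Q(W, Y)` of strong profunctors. -/
def tensor (P Q : StrongProf.{u}) : StrongProf.{u} where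
  toFunctor := tensorFunctor P Q
  str Z x := Comp.str Z x
  str_natural Z f g x := Comp.str_map Z f g x
  str_dinatural h x := Comp.map_str h x
  str_one x := Comp.map_str_one x
  str_str V W x := Comp.str_str V W x

/-- The element of `(P ⊗ Q)(X, Y)` represented by `p ∈ P(X, W)` and `q ∈ Q(W, Y)`. -/
def mk' {P Q : StrongProf.{u}} {X Y : FintypeCat.{u}} (W : FintypeCat.{u}) (p : P.obj X W)
    (q : Q.obj W Y) : (tensor P Q).obj X Y :=
  Comp.mk W p q

theorem glue {P Q : StrongProf.{u}} {X Y W W' : FintypeCat.{u}} (f : W ⟶ W') (p : P.obj X W)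
    (q : Q.obj W' Y) :
    (mk' W p (Q.map f (𝟙 Y) q) : (tensor P Q).obj X Y) = mk' W' (P.map (𝟙 X) f p) q :=
  Comp.glue f p q

@[elab_as_elim]
theorem ind {P Q : StrongProf.{u}} {X Y : FintypeCat.{u}} {r : (tensor P Q).obj X Y → Prop}
    (h : ∀ W p q, r (mk' W p q)) (x : (tensor P Q).obj X Y) : r x :=
  Comp.ind h x

/-- The universal property of the coend defining `(P ⊗ Q)(X, Y)`. -/
def desc {P Q : StrongProf.{u}} {X Y : FintypeCat.{u}} {T : Type u}
    (φ : ∀ W : FintypeCat.{u}, P.obj X W → Q.obj W Y → T)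
    (h : ∀ (W W' : FintypeCat.{u}) (f : W ⟶ W') (p : P.obj X W) (q : Q.obj W' Y),
      φ W p (Q.map f (𝟙 Y) q) = φ W' (P.map (𝟙 X) f p) q) : (tensor P Q).obj X Y → T :=
  Comp.desc φ h

@[simp]
theorem desc_mk' {P Q : StrongProf.{u}} {X Y : FintypeCat.{u}} {T : Type u}
    (φ : ∀ W : FintypeCat.{u}, P.obj X W → Q.obj W Y → T)
    (h : ∀ (W W' : FintypeCat.{u}) (f : W ⟶ W') (p : P.obj X W) (q : Q.obj W' Y),
      φ W p (Q.map f (𝟙 Y) q) = φ W' (P.map (𝟙 X) f p) q) (W : FintypeCat.{u})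
    (p : P.obj X W) (q : Q.obj W Y) : desc φ h (mk' W p q) = φ W p q :=
  Comp.desc_mk φ h W p q

@[simp]
theorem tensor_map {P Q : StrongProf.{u}} {X X' Y Y' : FintypeCat.{u}} (f : X' ⟶ X) (g : Y ⟶ Y')
    (W : FintypeCat.{u}) (p : P.obj X W) (q : Q.obj W Y) :
    (tensor P Q).map f g (mk' W p q) = mk' W (P.map f (𝟙 W) p) (Q.map (𝟙 W) g q) :=
  Comp.map_mk f g W p q

@[simp]
theorem tensor_str {P Q : StrongProf.{u}} {X Y : FintypeCat.{u}} (Z W : FintypeCat.{u})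
    (p : P.obj X W) (q : Q.obj W Y) :
    (tensor P Q).str Z (mk' W p q) = mk' (fprod W Z) (P.str Z p) (Q.str Z q) :=
  Comp.str_mk Z W p q

/-- The action `σ ⊗ τ : P ⊗ Q ⟶ P' ⊗ Q'` of the tensor product on morphisms. -/
def tensorMap {P P' Q Q' : StrongProf.{u}} (σ : P ⟶ P') (τ : Q ⟶ Q') :
    tensor P Q ⟶ tensor P' Q' :=
  homMk (fun X Y => desc (fun W p q => mk' W (Hom.app σ X W p) (Hom.app τ W Y q))
    (by
      intro W W' f p q
      rw [naturality, naturality]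
      exact glue f _ _))
    (by
      intro X X' Y Y' f g x
      induction x using ind with | _ W p q
      simp [naturality])
    (by
      intro X Y Z x
      induction x using ind with | _ W p q
      simp [app_str])

@[simp]
theorem tensorMap_mk {P P' Q Q' : StrongProf.{u}} (σ : P ⟶ P') (τ : Q ⟶ Q')
    {X Y : FintypeCat.{u}} (W : FintypeCat.{u}) (p : P.obj X W) (q : Q.obj W Y) :
    Hom.app (tensorMap σ τ) X Y (mk' W p q) = mk' W (Hom.app σ X W p) (Hom.app τ W Y q) := by
  simp [tensorMap]

/-- The left unitor `Hom ⊗ P ⟶ P`. -/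
def leftUnitorHom (P : StrongProf.{u}) : tensor hom P ⟶ P :=
  homMk (fun X Y => desc (P := hom) (Q := P) (fun _ f p => P.map f (𝟙 Y) p)
      (fun W W' f p q => by simp))
    (by
      intro X X' Y Y' f g x
      induction x using ind with | _ W p q
      simp)
    (by
      intro X Y Z x
      induction x using ind with | _ W p q
      simp [str_map])

@[simp]
theorem leftUnitorHom_mk (P : StrongProf.{u}) {X Y : FintypeCat.{u}} (W : FintypeCat.{u})
    (f : hom.obj X W) (p : P.obj W Y) :
    Hom.app (leftUnitorHom P) X Y (mk' W f p) = P.map f (𝟙 Y) p := by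
  simp [leftUnitorHom]

theorem leftUnitorHom_bijective (P : StrongProf.{u}) (X Y : FintypeCat.{u}) :
    Function.Bijective (Hom.app (leftUnitorHom P) X Y) := by
  have key : ∀ x : (tensor hom P).obj X Y,
      x = mk' (P := hom) X (𝟙 X) (Hom.app (leftUnitorHom P) X Y x) := by
    intro x
    induction x using ind with | _ W f p
    rw [leftUnitorHom_mk]
    have e := glue (P := hom) (Q := P) f (𝟙 X) p
    rw [hom_map] at e
    simpa using e.symm
  refine ⟨fun x y h => ?_, fun p => ⟨mk' (P := hom) X (𝟙 X) p, ?_⟩⟩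
  · rw [key x, key y, h]
  · simp

/-- The right unitor `P ⊗ Hom ⟶ P`. -/
def rightUnitorHom (P : StrongProf.{u}) : tensor P hom ⟶ P :=
  homMk (fun X Y => desc (P := P) (Q := hom) (fun _ p f => P.map (𝟙 X) f p)
      (fun W W' f p q => by simp))
    (by
      intro X X' Y Y' f g x
      induction x using ind with | _ W p q
      simp)
    (by
      intro X Y Z x
      induction x using ind with | _ W p q
      simp [str_map])

@[simp]
theorem rightUnitorHom_mk (P : StrongProf.{u}) {X Y : FintypeCat.{u}} (W : FintypeCat.{u})
    (p : P.obj X W) (f : hom.obj W Y) :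
    Hom.app (rightUnitorHom P) X Y (mk' W p f) = P.map (𝟙 X) f p := by
  simp [rightUnitorHom]

theorem rightUnitorHom_bijective (P : StrongProf.{u}) (X Y : FintypeCat.{u}) :
    Function.Bijective (Hom.app (rightUnitorHom P) X Y) := by
  have key : ∀ x : (tensor P hom).obj X Y,
      x = mk' (Q := hom) Y (Hom.app (rightUnitorHom P) X Y x) (𝟙 Y) := by
    intro x
    induction x using ind with | _ W p f
    rw [rightUnitorHom_mk]
    have e := glue (P := P) (Q := hom) f p (𝟙 Y)
    rw [hom_map] at e
    simpa using e
  refine ⟨fun x y h => ?_, fun p => ⟨mk' (Q := hom) Y p (𝟙 Y), ?_⟩⟩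
  · rw [key x, key y, h]
  · simp

/-- The associator `(P ⊗ Q) ⊗ R ⟶ P ⊗ (Q ⊗ R)`. -/
def associatorHom (P Q R : StrongProf.{u}) : tensor (tensor P Q) R ⟶ tensor P (tensor Q R) :=
  homMk (fun X Y => desc (P := tensor P Q) (Q := R) (fun V x r =>
        desc (P := P) (Q := Q) (fun W p q => mk' (Q := tensor Q R) W p (mk' V q r))
      (by
        intro W W' f p q
        have e := glue (Q := tensor Q R) f p (mk' V q r)
        simpa using e) x)
      (by
        intro V V' f x r
        induction x using ind with | _ W p q
        simp [glue]))
    (by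
      intro X X' Y Y' f g x
      induction x using ind with | _ V x r
      induction x using ind with | _ W p q
      simp)
    (by
      intro X Y Z x
      induction x using ind with | _ V x r
      induction x using ind with | _ W p q
      simp)

@[simp]
theorem associatorHom_mk (P Q R : StrongProf.{u}) {X Y : FintypeCat.{u}} (V W : FintypeCat.{u})
    (p : P.obj X W) (q : Q.obj W V) (r : R.obj V Y) :
    Hom.app (associatorHom P Q R) X Y (mk' V (mk' (P := P) (Q := Q) W p q) r) =
      mk' W p (mk' V q r) := by
  simp [associatorHom]

/-- The inverse of the associator, on components. -/
def associatorInv (P Q R : StrongProf.{u}) (X Y : FintypeCat.{u}) :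
    (tensor P (tensor Q R)).obj X Y → (tensor (tensor P Q) R).obj X Y :=
  desc (P := P) (Q := tensor Q R) (fun W p x =>
      desc (P := Q) (Q := R) (fun V q r => mk' (P := tensor P Q) V (mk' W p q) r)
      (by
        intro V V' f q r
        have e := glue (P := tensor P Q) f (mk' W p q) r
        simpa using e) x)
    (by
      intro W W' f p x
      induction x using ind with | _ V q r
      simp [glue])

@[simp]
theorem associatorInv_mk (P Q R : StrongProf.{u}) {X Y : FintypeCat.{u}} (V W : FintypeCat.{u})
    (p : P.obj X W) (q : Q.obj W V) (r : R.obj V Y) :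
    associatorInv P Q R X Y (mk' W p (mk' (P := Q) (Q := R) V q r)) = mk' V (mk' W p q) r := by
  simp [associatorInv]

theorem associatorHom_bijective (P Q R : StrongProf.{u}) (X Y : FintypeCat.{u}) :
    Function.Bijective (Hom.app (associatorHom P Q R) X Y) := by
  refine Function.bijective_iff_has_inverse.2 ⟨associatorInv P Q R X Y, fun x => ?_, fun x => ?_⟩
  · induction x using ind with | _ V x r
    induction x using ind with | _ W p q
    simp
  · induction x using ind with | _ W p x
    induction x using ind with | _ V q r
    simp

/-- The monoidal structure on strong endoprofunctors given by Bénabou's tensor product. -/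
instance : MonoidalCategory StrongProf.{u} where
  tensorObj := tensor
  tensorUnit := hom
  tensorHom := tensorMap
  whiskerLeft P _ _ τ := tensorMap (𝟙 P) τ
  whiskerRight σ Q := tensorMap σ (𝟙 Q)
  associator P Q R := isoMk (associatorHom P Q R) (associatorHom_bijective P Q R)
  leftUnitor P := isoMk (leftUnitorHom P) (leftUnitorHom_bijective P)
  rightUnitor P := isoMk (rightUnitorHom P) (rightUnitorHom_bijective P)
  tensorHom_def σ τ := by
    ext X Y x
    induction x using ind with | _ W p q
    simp
  id_tensorHom_id P Q := by
    ext X Y x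
    induction x using ind with | _ W p q
    simp
  tensorHom_comp_tensorHom _ _ _ _ := by
    ext X Y x
    induction x using ind with | _ W p q
    simp
  whiskerLeft_id P Q := by
    ext X Y x
    induction x using ind with | _ W p q
    simp
  id_whiskerRight P Q := by
    ext X Y x
    induction x using ind with | _ W p q
    simp
  associator_naturality _ _ _ := by
    ext X Y x
    induction x using ind with | _ V x r
    induction x using ind with | _ W p q
    simp
  leftUnitor_naturality τ := by
    ext X Y x
    induction x using ind with | _ W p q
    simp [naturality]
  rightUnitor_naturality τ := by
    ext X Y x
    induction x using ind with | _ W p q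
    simp [naturality]
  pentagon _ _ _ _ := by
    ext X Y x
    induction x using ind with | _ U x s
    induction x using ind with | _ V x r
    induction x using ind with | _ W p q
    simp
  triangle P Q := by
    ext X Y x
    induction x using ind with | _ V x r
    induction x using ind with | _ W p q
    simp [glue]

end StrongProf

/-! ### The Kleisli adjunction -/

/-- The functor `(-)^* : Prof_s ⥤ [𝔽, 𝕊]`, `P^*(Z) = P(1, Z)`. -/
def upperStar : StrongProf.{u} ⥤ FinFunctor.{u} where
  obj P := ⟨P.left fone⟩
  map τ := FinFunctor.homMk (fun Z => StrongProf.Hom.app τ fone Z)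
    fun _ _ g p => StrongProf.naturality τ (𝟙 fone) g p

/-- The strong profunctor `F_*(X, Y) = (X → F Y)`, with strength
`str v (x, z) = F(y ↦ (y, z)) (v x)`. -/
abbrev lowerStarObj (F : FinFunctor.{u}) : StrongProf.{u} where
  toFunctor :=
    { obj := fun X => X.1.unop.obj → F.obj X.2
      map := fun f => ↾fun v x => F.map f.2 (v (f.1.unop x))
      map_id := by
        intro X
        ext v x
        exact F.map_id (v x)
      map_comp := by
        intro X Y Z f g
        ext v x
        exact F.map_comp f.2 g.2 _ }
  str Z v := fun p => F.map (fpair _ p.2) (v p.1)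
  str_natural Z f g v := by
    funext p
    exact (F.map_comp g (fpair _ p.2) (v (f p.1))).symm.trans
      (F.map_comp (fpair _ p.2) (fmap₂ g (𝟙 Z)) (v (f p.1)))
  str_dinatural {X Y Z Z'} h v := by
    funext p
    exact (F.map_id _).trans (F.map_comp (fpair Y p.2) (fmap₂ (𝟙 Y) h) _)
  str_one {X Y} v := by
    funext p
    exact (F.map_comp (fpair Y p.2) (fproj₁ Y fone) _).symm
  str_str {X Y} V W v := by
    funext p
    exact (F.map_comp (fpair Y p.1.2) (fpair _ p.2) _).symm.trans
      (F.map_comp (fpair Y (p.1.2, p.2)) (fassoc Y V W) _)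

@[simp]
theorem lowerStarObj_map (F : FinFunctor.{u}) {X X' Y Y' : FintypeCat.{u}} (f : X' ⟶ X)
    (g : Y ⟶ Y') (v : (lowerStarObj F).obj X Y) :
    (lowerStarObj F).map f g v = fun x => F.map g (v (f x)) := rfl

@[simp]
theorem lowerStarObj_str (F : FinFunctor.{u}) {X Y : FintypeCat.{u}} (Z : FintypeCat.{u})
    (v : (lowerStarObj F).obj X Y) :
    (lowerStarObj F).str Z v = fun p => F.map (fpair Y p.2) (v p.1) := rfl

/-- The functor `(-)_* : [𝔽, 𝕊] ⥤ Prof_s`, `F_*(X, Y) = (X → F Y)`. -/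
def lowerStar : FinFunctor.{u} ⥤ StrongProf.{u} where
  obj := lowerStarObj
  map {F G} τ := StrongProf.homMk (P := lowerStarObj F) (Q := lowerStarObj G)
    (fun _ Y v x => FinFunctor.Hom.app τ Y (v x))
    (by
      intro X X' Y Y' f g v
      funext x
      exact FinFunctor.naturality τ g _)
    (by
      intro X Y Z v
      funext p
      exact FinFunctor.naturality τ _ _)

/-- The strength of a strong profunctor is determined on elements of the contravariant argument. -/
theorem StrongProf.map_fpoint_str (P : StrongProf.{u}) {X Y Z : FintypeCat.{u}} (x : X) (z : Z)
    (p : P.obj X Y) :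
    P.map (fpoint (X := fprod X Z) (x, z)) (𝟙 _) (P.str Z p) =
      P.map (𝟙 fone) (fpair Y z) (P.map (fpoint x) (𝟙 Y) p) := by
  let d : fone.{u} ⟶ fprod fone fone := fpoint (X := fprod fone fone) (PUnit.unit, PUnit.unit)
  have h₁ := P.str_map Z (fpoint x) (𝟙 Y) p
  have h₂ := P.map_str (fpoint z) (P.map (fpoint x) (𝟙 Y) p)
  have h₃ := P.map_str_one (P.map (fpoint x) (𝟙 Y) p)
  have h₄ := congrArg (P.map d (𝟙 _)) h₂
  have h₅ := congrArg (P.map d (fpair Y z)) h₃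
  rw [h₁] at h₄
  simp only [map_map] at h₄ h₅ ⊢
  exact h₄.trans h₅

/-- The unit `η_P : P(X, Y) → (X → P(1, Y))`, which sends `p` to `x ↦ P(x, id) p`. -/
def kleisliUnit (P : StrongProf.{u}) : P ⟶ lowerStar.obj (upperStar.obj P) :=
  StrongProf.homMk (P := P) (Q := lowerStarObj (upperStar.obj P))
    (fun X Y p x => P.map (fpoint x) (𝟙 Y) p)
    (by
      intro X X' Y Y' f g p
      funext x
      change P.map _ _ (P.map _ _ p) = P.map _ _ (P.map _ _ p)
      simp
      rfl)
    (by
      intro X Y Z p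
      funext q
      obtain ⟨x, z⟩ := q
      change P.map (fpoint (x, z)) (𝟙 _) (P.str Z p) =
        P.map (𝟙 fone) (fpair Y z) (P.map (fpoint x) (𝟙 Y) p)
      exact P.map_fpoint_str x z p)

/-- The counit `ε_F : (1 → F Z) → F Z`, evaluation at the element of `1`. -/
def kleisliCounit (F : FinFunctor.{u}) : upperStar.obj (lowerStar.obj F) ⟶ F :=
  FinFunctor.homMk (F := upperStar.obj (lowerStarObj F)) (fun _ v => v PUnit.unit)
    (fun _ _ _ _ => rfl)

/-- The Kleisli adjunction `(-)^* ⊣ (-)_*`. -/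
def kleisliAdjunction : upperStar.{u} ⊣ lowerStar.{u} where
  unit :=
    { app := kleisliUnit
      naturality := by
        intro P Q τ
        ext X Y p
        funext x
        exact (StrongProf.naturality τ (fpoint x) (𝟙 Y) p).symm }
  counit :=
    { app := kleisliCounit
      naturality := by
        intro F G τ
        rfl }
  left_triangle_components P := by
    ext Z p
    exact P.map_id p
  right_triangle_components F := by
    ext X Y v
    funext x
    exact F.map_id (v x)

/-- The monad `◇ P = (P^*)_*` on strong profunctors. -/
def diamond : Monad StrongProf.{u} := kleisliAdjunction.toMonad

/-- The morphism `ξ₀ : Hom ⟶ i_*`, the identity `Hom(X, Y) → (X → Y)`. -/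
def xiZero : 𝟙_ StrongProf.{u} ⟶ lowerStar.obj (𝟙_ FinFunctor.{u}) :=
  StrongProf.homMk (P := StrongProf.hom) (Q := lowerStarObj FinFunctor.incl)
    (fun _ _ f x => f x) (fun _ _ _ _ _ _ _ => rfl) (fun _ _ _ _ => rfl)

/-- The components `(F_* ⊗ G_*)(X, Y) → (X → (F ∘ G)(Y))` of `ξ`, induced by
`(v, w) ↦ (x ↦ [v x, w])` for `v : X → F W` and `w : W → G Y`. -/
def xiApp (F G : FinFunctor.{u}) (X Y : FintypeCat.{u}) :
    (StrongProf.tensor (lowerStarObj F) (lowerStarObj G)).obj X Y →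
      (lowerStarObj (FinFunctor.subst F G)).obj X Y :=
  StrongProf.desc (P := lowerStarObj F) (Q := lowerStarObj G)
    (fun W v w x => FinFunctor.mk' W (v x) w)
    (by
      intro W W' f v w
      funext x
      have e := FinFunctor.glue (F := F) (G := G) f (v x) w
      simpa using e)

@[simp]
theorem xiApp_mk (F G : FinFunctor.{u}) (X Y W : FintypeCat.{u}) (v : (lowerStarObj F).obj X W)
    (w : (lowerStarObj G).obj W Y) :
    xiApp F G X Y (StrongProf.mk' W v w) = fun x => FinFunctor.mk' W (v x) w := by
  simp [xiApp]

/-- The morphism `ξ : F_* ⊗ G_* ⟶ (F ∘ G)_*`. -/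
def xi (F G : FinFunctor.{u}) : lowerStar.obj F ⊗ lowerStar.obj G ⟶ lowerStar.obj (F ⊗ G) :=
  StrongProf.homMk (P := StrongProf.tensor (lowerStarObj F) (lowerStarObj G))
    (Q := lowerStarObj (FinFunctor.subst F G)) (xiApp F G)
    (by
      intro X X' Y Y' f g x
      induction x using StrongProf.ind with | _ W v w
      simp)
    (by
      intro X Y Z x
      induction x using StrongProf.ind with | _ W v w
      simp only [StrongProf.tensor_str, xiApp_mk, FinFunctor.subst_map]
      funext p
      exact (FinFunctor.glue (F := F) (G := G) (fpair W p.2) (v p.1)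
        fun q => G.map (fpair Y q.2) (w q.1)).symm)

@[simp]
theorem xi_mk (F G : FinFunctor.{u}) (X Y W : FintypeCat.{u}) (v : (lowerStarObj F).obj X W)
    (w : (lowerStarObj G).obj W Y) :
    StrongProf.Hom.app (xi F G) X Y (StrongProf.mk' W v w) =
      fun x => FinFunctor.mk' W (v x) w :=
  xiApp_mk F G X Y W v w

@[simp]
theorem lowerStar_map_app {F G : FinFunctor.{u}} (τ : F ⟶ G) (X Y : FintypeCat.{u})
    (v : (lowerStarObj F).obj X Y) :
    StrongProf.Hom.app (lowerStar.map τ) X Y v = fun x => FinFunctor.Hom.app τ Y (v x) := rfl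

/-- The lax monoidal structure `(ξ, ξ₀)` on `(-)_*`. -/
instance : lowerStar.{u}.LaxMonoidal where
  ε := xiZero
  μ := xi
  μ_natural_left {F G} τ H := by
    ext X Y x
    induction x using StrongProf.ind with | _ W v w
    change StrongProf.Hom.app (xi G H) X Y (StrongProf.Hom.app
        (StrongProf.tensorMap (lowerStar.map τ) (𝟙 (lowerStar.obj H))) X Y
          (StrongProf.mk' W v w)) =
      fun x => FinFunctor.Hom.app (FinFunctor.substMap τ (𝟙 H)) Y
        (StrongProf.Hom.app (xi F H) X Y (StrongProf.mk' W v w) x)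
    rw [StrongProf.tensorMap_mk]
    erw [xi_mk, xi_mk]
    funext x
    exact (FinFunctor.substMap_mk τ (𝟙 H) W (v x) w).symm
  μ_natural_right {F G} H τ := by
    ext X Y x
    induction x using StrongProf.ind with | _ W v w
    change StrongProf.Hom.app (xi H G) X Y (StrongProf.Hom.app
        (StrongProf.tensorMap (𝟙 (lowerStar.obj H)) (lowerStar.map τ)) X Y
          (StrongProf.mk' W v w)) =
      fun x => FinFunctor.Hom.app (FinFunctor.substMap (𝟙 H) τ) Y
        (StrongProf.Hom.app (xi H F) X Y (StrongProf.mk' W v w) x)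
    rw [StrongProf.tensorMap_mk]
    erw [xi_mk, xi_mk]
    funext x
    exact (FinFunctor.substMap_mk (𝟙 H) τ W (v x) w).symm
  associativity F G H := by
    ext X Y x
    induction x using StrongProf.ind with | _ V x w
    induction x using StrongProf.ind with | _ W u v
    change (fun x => FinFunctor.Hom.app (FinFunctor.associatorHom F G H) Y
        (StrongProf.Hom.app (xi (F ⊗ G) H) X Y (StrongProf.Hom.app
          (StrongProf.tensorMap (xi F G) (𝟙 (lowerStar.obj H))) X Y
            (StrongProf.mk' V (StrongProf.mk' W u v) w)) x)) =
      StrongProf.Hom.app (xi F (G ⊗ H)) X Y (StrongProf.Hom.app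
        (StrongProf.tensorMap (𝟙 (lowerStar.obj F)) (xi G H)) X Y
          (StrongProf.Hom.app (StrongProf.associatorHom
            (lowerStar.obj F) (lowerStar.obj G) (lowerStar.obj H)) X Y
            (StrongProf.mk' V (StrongProf.mk' W u v) w)))
    rw [StrongProf.tensorMap_mk, StrongProf.associatorHom_mk]
    erw [xi_mk, xi_mk, StrongProf.tensorMap_mk, xi_mk, xi_mk]
    funext x
    exact FinFunctor.associatorHom_mk F G H V W (u x) v w
  left_unitality F := by
    ext X Y x
    induction x using StrongProf.ind with | _ W u v
    change StrongProf.Hom.app (StrongProf.leftUnitorHom (lowerStar.obj F)) X Y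
        (StrongProf.mk' W u v) =
      fun x => FinFunctor.Hom.app (FinFunctor.leftUnitorHom F) Y
        (StrongProf.Hom.app (xi (𝟙_ FinFunctor) F) X Y (StrongProf.Hom.app
          (StrongProf.tensorMap xiZero (𝟙 (lowerStar.obj F))) X Y
            (StrongProf.mk' W u v)) x)
    rw [StrongProf.leftUnitorHom_mk]
    erw [StrongProf.tensorMap_mk, xi_mk]
    funext x
    exact (F.map_id _).trans (FinFunctor.leftUnitorHom_mk F W _ v).symm
  right_unitality F := by
    ext X Y x
    induction x using StrongProf.ind with | _ W u v
    change StrongProf.Hom.app (StrongProf.rightUnitorHom (lowerStar.obj F)) X Y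
        (StrongProf.mk' W u v) =
      fun x => FinFunctor.Hom.app (FinFunctor.rightUnitorHom F) Y
        (StrongProf.Hom.app (xi F (𝟙_ FinFunctor)) X Y (StrongProf.Hom.app
          (StrongProf.tensorMap (𝟙 (lowerStar.obj F)) xiZero) X Y
            (StrongProf.mk' W u v)) x)
    rw [StrongProf.rightUnitorHom_mk]
    erw [StrongProf.tensorMap_mk, xi_mk]
    funext x
    exact (FinFunctor.rightUnitorHom_mk F W (u x) _).symm

/-! ### Monoids with an algebra structure -/

/-- A `T`-monoid for a monad `T` on a monoidal category: a monoid `(M, m, e)` together with a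
`T`-algebra structure `α : T M ⟶ M` on its underlying object. -/
structure MonadMon {C : Type*} [Category C] [MonoidalCategory C] (T : Monad C) where
  /-- The underlying monoid. -/
  toMon : Mon C
  /-- The algebra structure map. -/
  a : T.obj toMon.X ⟶ toMon.X
  unit : T.η.app toMon.X ≫ a = 𝟙 toMon.X
  assoc : T.μ.app toMon.X ≫ a = T.map a ≫ a

namespace MonadMon

variable {C : Type*} [Category C] [MonoidalCategory C] {T : Monad C}

/-- A morphism of `T`-monoids is a monoid morphism which is also a morphism of `T`-algebras. -/
@[ext]
structure Hom (M N : MonadMon T) where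
  /-- The underlying morphism of monoids. -/
  toHom : M.toMon ⟶ N.toMon
  map_comp : T.map toHom.hom ≫ N.a = M.a ≫ toHom.hom

/-- The category `Mon(T)` of `T`-monoids. -/
instance : Category (MonadMon T) where
  Hom := Hom
  id M := { toHom := 𝟙 M.toMon, map_comp := by simp }
  comp f g :=
    { toHom := f.toHom ≫ g.toHom
      map_comp := by
        rw [Mon.comp_hom', Functor.map_comp, Category.assoc, g.map_comp, ← Category.assoc,
          f.map_comp, Category.assoc] }

/-- The functor forgetting the `T`-algebra structure. -/
def forget (T : Monad C) : MonadMon T ⥤ Mon C where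
  obj M := M.toMon
  map f := f.toHom

end MonadMon

/-! ### Arrows -/

section Arrow

variable (A : StrongProf.{u}) [MonObj A]

/-- The operation `arr : (X → Y) → A(X, Y)` of an arrow (a monoid in strong profunctors). -/
def arr {X Y : FintypeCat.{u}} (f : X ⟶ Y) : A.obj X Y :=
  StrongProf.Hom.app (P := StrongProf.hom) (MonObj.one (X := A)) X Y f

/-- The sequential composition `c >>> d` of an arrow. -/
def seqComp {X Y Z : FintypeCat.{u}} (c : A.obj X Y) (d : A.obj Y Z) : A.obj X Z :=
  StrongProf.Hom.app (P := StrongProf.tensor A A) (MonObj.mul (X := A)) X Z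
    (StrongProf.mk' Y c d)

/-- The map `eval : A(X, Y) → (X → A(1, Y))`, `eval c x = arr (λ (). x) >>> c`. -/
def eval (X Y : FintypeCat.{u}) (c : A.obj X Y) (x : X) : A.obj fone Y :=
  seqComp A (arr A (fpoint x)) c

end Arrow

end

end Computation

/-! An element of `X` is a map `1 ⟶ X`, and the whole argument is restriction along such points. The
profunctor `F_*` is determined by its values at `X = 1`, so the counit `(F_*)^* ⟶ F` is invertible,
`(-)_*` is fully faithful and `◇` is idempotent. Hence being a `◇`-algebra is a property of `P`: the
unit law alone makes the structure map a two-sided inverse of `η_P` (`comp_unit_of_unit_comp`),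
conversely an inverse of `η_P` is automatically associative, and naturality of `η` makes every
morphism between algebras an algebra morphism. For an arrow the left unit law reads `arr f >>> c =
P(f, id) c`, so `eval` is `η_P`, which gives the criterion in 3.

Part 1 compares coends: at `X = 1` both sides of the second map are `∫^W P(1, W) × (W → F Z)`, up to
replacing a set by the functions from `1` into it.

For the equivalence, the lax monoidal functor `(-)_*` lifts to `comparison`, with algebra structure
the image of the counit. It is fully faithful: a morphism `F_* ⟶ G_*` comes from a unique `σ : F ⟶
G`, and the monoid equations for `σ`, known only after precomposition with `ξ₀` and `ξ`, descend
because at `X = 1` these two maps reach every representative (`hom_ext_of_xiZero`, `hom_ext_of_xi`).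
It is essentially surjective: if `η_A` is invertible, a family `k : C → A(1, X)` is the same as an
element `uncurry k` of `A(C, X)`, and `[a, k] ↦ a >>> uncurry k` makes `A^*` a finitary monad. Then
`η_A : A ⟶ (A^*)_*` is an isomorphism of arrows, which lifts to `◇`-monoids since the forgetful
functor is fully faithful. -/

namespace Computation

noncomputable section

/-! ### The monoid axioms of an arrow, on elements -/

section ArrowLaws

variable (A : StrongProf.{u}) [MonObj A]

theorem map_arr {X X' Y Y' : FintypeCat.{u}} (f : X' ⟶ X) (h : X ⟶ Y) (g : Y ⟶ Y') :
    A.map f g (arr A h) = arr A (f ≫ h ≫ g) :=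
  (StrongProf.naturality (P := StrongProf.hom) (MonObj.one (X := A)) f g h).symm

theorem map_seqComp {X X' Y Z Z' : FintypeCat.{u}} (f : X' ⟶ X) (g : Z ⟶ Z') (c : A.obj X Y)
    (d : A.obj Y Z) :
    A.map f g (seqComp A c d) = seqComp A (A.map f (𝟙 Y) c) (A.map (𝟙 Y) g d) := by
  refine (StrongProf.naturality (P := StrongProf.tensor A A) (MonObj.mul (X := A)) f g
    (StrongProf.mk' Y c d)).symm.trans ?_
  rw [StrongProf.tensor_map]
  rfl

/-- This is the coend relation of `A ⊗ A`, seen through the multiplication. -/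
theorem seqComp_map {X Y Y' Z : FintypeCat.{u}} (f : Y ⟶ Y') (c : A.obj X Y) (d : A.obj Y' Z) :
    seqComp A c (A.map f (𝟙 Z) d) = seqComp A (A.map (𝟙 X) f c) d :=
  congrArg _ (StrongProf.glue f c d)

/-- The left unit law evaluated at `[f, c]`: the left unitor acts by `A(f, id)`. With `f` a point,
this identifies `eval` with the Kleisli unit. -/
theorem arr_seqComp {X Y Z : FintypeCat.{u}} (f : X ⟶ Y) (c : A.obj Y Z) :
    seqComp A (arr A f) c = A.map f (𝟙 Z) c := by
  have h := congrArg (fun τ => StrongProf.Hom.app τ X Z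
    (StrongProf.mk' (P := StrongProf.hom) Y f c)) (MonObj.one_mul A)
  refine Eq.trans ?_ (h.trans (StrongProf.leftUnitorHom_mk A Y f c))
  exact (congrArg (StrongProf.Hom.app (P := StrongProf.tensor A A) (MonObj.mul (X := A)) X Z)
    (StrongProf.tensorMap_mk (P := StrongProf.hom) (MonObj.one (X := A)) (𝟙 A) Y f c)).symm

theorem seqComp_arr {X Y Z : FintypeCat.{u}} (c : A.obj X Y) (f : Y ⟶ Z) :
    seqComp A c (arr A f) = A.map (𝟙 X) f c := by
  have h := congrArg (fun τ => StrongProf.Hom.app τ X Z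
    (StrongProf.mk' (Q := StrongProf.hom) Y c f)) (MonObj.mul_one A)
  refine Eq.trans ?_ (h.trans (StrongProf.rightUnitorHom_mk A Y c f))
  exact (congrArg (StrongProf.Hom.app (P := StrongProf.tensor A A) (MonObj.mul (X := A)) X Z)
    (StrongProf.tensorMap_mk (Q := StrongProf.hom) (𝟙 A) (MonObj.one (X := A)) Y c f)).symm

theorem seqComp_assoc {W X Y Z : FintypeCat.{u}} (b : A.obj W X) (c : A.obj X Y)
    (d : A.obj Y Z) :
    seqComp A (seqComp A b c) d = seqComp A b (seqComp A c d) := by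
  let m : StrongProf.tensor A A ⟶ A := MonObj.mul (X := A)
  have h : StrongProf.Hom.app m W Z (StrongProf.Hom.app (StrongProf.tensorMap m (𝟙 A)) W Z
        (StrongProf.mk' Y (StrongProf.mk' X b c) d)) =
      StrongProf.Hom.app m W Z (StrongProf.Hom.app (StrongProf.tensorMap (𝟙 A) m) W Z
        (StrongProf.Hom.app (StrongProf.associatorHom A A A) W Z
          (StrongProf.mk' Y (StrongProf.mk' X b c) d))) :=
    congrArg (fun τ => StrongProf.Hom.app τ W Z
      (StrongProf.mk' (P := StrongProf.tensor A A) Y (StrongProf.mk' X b c) d))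
      (MonObj.mul_assoc A)
  rw [StrongProf.tensorMap_mk, StrongProf.associatorHom_mk, StrongProf.tensorMap_mk] at h
  exact h

/-- Restriction to a point touches only the first factor of a composite; this is what reduces
associativity for `A^*` to associativity in `A`. -/
theorem map_fpoint_seqComp {X Y Z : FintypeCat.{u}} (c : A.obj X Y) (d : A.obj Y Z) (x : X) :
    A.map (fpoint x) (𝟙 Z) (seqComp A c d) = seqComp A (A.map (fpoint x) (𝟙 Y) c) d := by
  rw [map_seqComp, StrongProf.map_id]

/-- For an arrow, `eval` is the unit of the Kleisli adjunction. -/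
theorem eval_eq_kleisliUnit (X Y : FintypeCat.{u}) :
    eval A X Y = StrongProf.Hom.app (kleisliUnit A) X Y := by
  funext c x
  exact arr_seqComp A (fpoint x) c

end ArrowLaws

/-! ### Invertibility of components -/

theorem FinFunctor.isIso_of_bijective {F G : FinFunctor.{u}} (τ : F ⟶ G)
    (h : ∀ X : FintypeCat.{u}, Function.Bijective (Hom.app τ X)) : IsIso τ :=
  (isoMk τ h).isIso_hom

theorem StrongProf.isIso_iff_bijective {P Q : StrongProf.{u}} (τ : P ⟶ Q) :
    IsIso τ ↔ ∀ X Y : FintypeCat.{u}, Function.Bijective (Hom.app τ X Y) := by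
  refine ⟨fun _ X Y => Function.bijective_iff_has_inverse.2 ⟨Hom.app (inv τ) X Y,
    fun p => ?_, fun p => ?_⟩, fun h => (isoMk τ h).isIso_hom⟩
  · rw [← comp_app, IsIso.hom_inv_id, id_app]
  · rw [← comp_app, IsIso.inv_hom_id, id_app]

theorem isIso_upperStar_xiZero : IsIso (upperStar.{u}.map xiZero) := by
  refine FinFunctor.isIso_of_bijective _ fun Z => ⟨fun f g h => ?_, fun v => ?_⟩
  · exact FintypeCat.hom_ext (X := fone) (Y := Z) f g fun x => congrFun h x
  · exact ⟨FintypeCat.homMk v, rfl⟩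

/-- Both sides are the same coend: `P(1, W)` is paired with `W → F Z`, and the two gluing relations
agree. The map sends `[p, w]` to the constant function on `1` with value `[p, w]`, because `η_P` at
the unique point of `1` is the identity. -/
theorem isIso_upperStar_unit_xi (P : StrongProf.{u}) (F : FinFunctor.{u}) :
    IsIso (upperStar.map (kleisliUnit P ▷ lowerStar.obj F ≫ xi (upperStar.obj P) F)) := by
  have key : ∀ (Z W : FintypeCat.{u}) (p : P.obj fone W) (w : (lowerStarObj F).obj W Z),
      FinFunctor.Hom.app (upperStar.map
        (kleisliUnit P ▷ lowerStar.obj F ≫ xi (upperStar.obj P) F)) Z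
          (StrongProf.mk' (Q := lowerStarObj F) W p w) =
        fun _ => FinFunctor.mk' (F := upperStar.obj P) W p w := by
    intro Z W p w
    have e : StrongProf.Hom.app (StrongProf.tensorMap (kleisliUnit P) (𝟙 (lowerStarObj F))) fone Z
        (StrongProf.mk' W p w) = _ := StrongProf.tensorMap_mk _ _ W p w
    refine (congrArg (StrongProf.Hom.app (xi (upperStar.obj P) F) fone Z) e).trans ?_
    refine (xi_mk (upperStar.obj P) F fone Z W _ _).trans ?_
    funext x
    exact congrArg (fun q => FinFunctor.mk' (F := upperStar.obj P) (G := F) W q w) (P.map_id p)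
  let back (Z : FintypeCat.{u}) : (FinFunctor.subst (upperStar.obj P) F).obj Z →
      (StrongProf.tensor P (lowerStarObj F)).obj fone Z :=
    FinFunctor.desc (F := upperStar.obj P)
      (fun W p w => StrongProf.mk' (Q := lowerStarObj F) W p w)
      (by
        intro C D f a k
        have e := StrongProf.glue (P := P) (Q := lowerStarObj F) f a k
        -- The gluing relation of `P ⊗ F_*` differs from that of the substitution product only by an
        -- occurrence of `F(id)`.
        rw [lowerStarObj_map] at e
        simp only [FinFunctor.map_id] at e
        exact e)
  -- The inverse evaluates at the element of `1` and reinterprets the resulting representative.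
  refine FinFunctor.isIso_of_bijective _ fun Z => Function.bijective_iff_has_inverse.2
    ⟨fun v => back Z (v PUnit.unit), fun x => ?_, fun v => ?_⟩
  · change (StrongProf.tensor P (lowerStarObj F)).obj fone Z at x
    induction x using StrongProf.ind with | _ W p w
    dsimp only
    erw [key]
    exact FinFunctor.desc_mk' _ _ _ _ _
  · change fone → (FinFunctor.subst (upperStar.obj P) F).obj Z at v
    obtain ⟨y, rfl⟩ : ∃ y, v = fun _ => y := ⟨v PUnit.unit, rfl⟩
    induction y using FinFunctor.ind with | _ W p w
    refine (congrArg _ (FinFunctor.desc_mk' _ _ _ _ _)).trans (key Z W p w)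

/-! ### Algebras of the idempotent monad `◇` -/

/-- Idempotence of `◇`: both maps send `v` to `x ↦ (y ↦ v x)` with `y` in `1`. -/
theorem diamond_map_unit (P : StrongProf.{u}) :
    diamond.map (diamond.η.app P) = diamond.η.app (diamond.obj P) := by
  ext X Y v
  funext x
  funext y
  change P.map (fpoint y) (𝟙 Y) (v x) = P.map (𝟙 fone) (𝟙 Y) (v x)
  -- The unique point `1 ⟶ 1` is definitionally the identity.
  rfl

/-- By naturality and `diamond_map_unit`, `a ≫ η_P = η_{◇P} ≫ ◇a = ◇η_P ≫ ◇a = ◇(η_P ≫ a)`, which is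
the identity. So a retraction of the unit is already its inverse. -/
theorem comp_unit_of_unit_comp {P : StrongProf.{u}} (a : diamond.obj P ⟶ P)
    (h : diamond.η.app P ≫ a = 𝟙 P) : a ≫ diamond.η.app P = 𝟙 (diamond.obj P) := by
  have e := diamond.η.naturality a
  dsimp only [Functor.id_map] at e
  rw [e]
  dsimp only [Functor.id_obj]
  rw [← diamond_map_unit, ← Functor.map_comp, h]
  exact CategoryTheory.Functor.map_id _ P

theorem MonadMon.isIso_unit (M : MonadMon diamond.{u}) : IsIso (kleisliUnit M.toMon.X) :=
  ⟨M.a, M.unit, comp_unit_of_unit_comp M.a M.unit⟩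

instance : (MonadMon.forget diamond.{u}).Faithful where
  map_injective h := MonadMon.Hom.ext h

/-- The structure maps are inverse to the unit, so the algebra square for `f` is the naturality
square of `η` at `f` with its sides inverted. -/
instance : (MonadMon.forget diamond.{u}).Full where
  map_surjective {M N} f := by
    refine ⟨⟨f, ?_⟩, rfl⟩
    change M.toMon ⟶ N.toMon at f
    have e := diamond.η.naturality f.hom
    dsimp only [Functor.id_map, Functor.id_obj] at e
    have h₁ := comp_unit_of_unit_comp M.a M.unit
    calc diamond.map f.hom ≫ N.a
        = (M.a ≫ diamond.η.app M.toMon.X) ≫ diamond.map f.hom ≫ N.a := by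
          rw [h₁, Category.id_comp]
      _ = M.a ≫ (diamond.η.app M.toMon.X ≫ diamond.map f.hom) ≫ N.a := by
          simp only [Category.assoc]
      _ = M.a ≫ (f.hom ≫ diamond.η.app N.toMon.X) ≫ N.a := congrArg (fun t => M.a ≫ t ≫ N.a) e.symm
      _ = M.a ≫ f.hom ≫ diamond.η.app N.toMon.X ≫ N.a := by simp only [Category.assoc]
      _ = M.a ≫ f.hom := by rw [N.unit]; exact congrArg (M.a ≫ ·) (Category.comp_id f.hom)

/-- The inverse of an invertible Kleisli unit, as a morphism from the value of `◇`. -/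
def kleisliInv (P : StrongProf.{u}) (h : IsIso (kleisliUnit P)) : diamond.obj P ⟶ P :=
  have := h
  (inv (kleisliUnit P) : lowerStar.obj (upperStar.obj P) ⟶ P)

theorem unit_comp_kleisliInv (P : StrongProf.{u}) (h : IsIso (kleisliUnit P)) :
    diamond.η.app P ≫ kleisliInv P h = 𝟙 P :=
  IsIso.hom_inv_id (kleisliUnit P)

/-- An arrow with invertible Kleisli unit is a `◇`-monoid. -/
def MonadMon.ofIsIso (A : Mon StrongProf.{u}) (h : IsIso (kleisliUnit A.X)) :
    MonadMon diamond.{u} where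
  toMon := A
  a := kleisliInv A.X h
  unit := unit_comp_kleisliInv A.X h
  assoc := by
    have h₁ : diamond.map (kleisliInv A.X h) ≫ diamond.map (diamond.η.app A.X) =
        𝟙 (diamond.obj (diamond.obj A.X)) := by
      rw [← Functor.map_comp, comp_unit_of_unit_comp _ (unit_comp_kleisliInv A.X h),
        CategoryTheory.Functor.map_id]
    -- Both `◇a` and `μ` are inverse to `◇η`, hence equal; the associativity law is then a
    -- tautology.
    have h₂ : diamond.map (kleisliInv A.X h) = diamond.μ.app A.X :=
      calc diamond.map (kleisliInv A.X h)
          = diamond.map (kleisliInv A.X h) ≫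
              diamond.map (diamond.η.app A.X) ≫ diamond.μ.app A.X := by
            rw [diamond.right_unit A.X]; exact (Category.comp_id _).symm
        _ = (diamond.map (kleisliInv A.X h) ≫ diamond.map (diamond.η.app A.X)) ≫
              diamond.μ.app A.X := (Category.assoc _ _ _).symm
        _ = diamond.μ.app A.X := by rw [h₁]; exact Category.id_comp _
    rw [h₂]

theorem exists_monadMon_iff (A : Mon StrongProf.{u}) :
    (∃ M : MonadMon diamond.{u}, M.toMon = A) ↔
      ∀ X Y : FintypeCat.{u}, Function.Bijective (eval A.X X Y) := by
  simp only [eval_eq_kleisliUnit]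
  refine Iff.trans ?_ (StrongProf.isIso_iff_bijective (kleisliUnit A.X))
  constructor
  · rintro ⟨M, rfl⟩
    exact M.isIso_unit
  · intro h
    exact ⟨MonadMon.ofIsIso A h, rfl⟩

/-! ### The comparison functor -/

/-- At `X = 1` the constant function with value `a` recovers the action of a transformation on `a`.
-/
theorem lowerStar_map_injective {F G : FinFunctor.{u}} {σ τ : F ⟶ G}
    (h : lowerStar.map σ = lowerStar.map τ) : σ = τ := by
  ext X a
  exact congrFun (congrArg (fun ρ => StrongProf.Hom.app ρ fone X fun _ => a) h) PUnit.unit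

/-- Each element `a` of `X` is the value of `ξ₀` on the point `1 ⟶ X` at `a`, so `ξ₀` can be
cancelled in front of maps of the form `σ_*`. -/
theorem hom_ext_of_xiZero {G : FinFunctor.{u}} {σ τ : 𝟙_ FinFunctor.{u} ⟶ G}
    (h : xiZero ≫ lowerStar.map σ = xiZero ≫ lowerStar.map τ) : σ = τ := by
  ext X a
  exact congrFun (congrArg (fun ρ => StrongProf.Hom.app ρ fone X (fpoint (X := X) a)) h) PUnit.unit

/-- Although `ξ` need not be surjective at a general `X`, where the intermediate set must serve all
`x` at once, at `X = 1` it reaches every `[a, k]`. This suffices to cancel it in front of maps of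
the form `σ_*`. -/
theorem hom_ext_of_xi {F G H : FinFunctor.{u}} {σ τ : F ⊗ G ⟶ H}
    (h : xi F G ≫ lowerStar.map σ = xi F G ≫ lowerStar.map τ) : σ = τ := by
  ext X a
  induction a using FinFunctor.ind with | _ C a k
  let y : (StrongProf.tensor (lowerStarObj F) (lowerStarObj G)).obj fone X :=
    StrongProf.mk' C (fun _ => a) k
  have hy : StrongProf.Hom.app (xi F G) fone X y = fun _ => FinFunctor.mk' C a k :=
    xi_mk F G fone X C _ k
  have e : (fun x => FinFunctor.Hom.app σ X (StrongProf.Hom.app (xi F G) fone X y x)) =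
      fun x => FinFunctor.Hom.app τ X (StrongProf.Hom.app (xi F G) fone X y x) :=
    congrArg (fun ρ => StrongProf.Hom.app ρ fone X y) h
  rw [hy] at e
  exact congrFun e PUnit.unit

/-- A morphism `F_* ⟶ G_*` comes from a morphism `F ⟶ G`. -/
theorem exists_lowerStar_map {F G : FinFunctor.{u}} (τ : lowerStar.obj F ⟶ lowerStar.obj G) :
    ∃ σ : F ⟶ G, lowerStar.map σ = τ := by
  -- The component of `σ` is `τ` at `X = 1`; naturality of `τ` along points then determines `τ`
  -- everywhere.
  refine ⟨FinFunctor.homMk (fun X a => StrongProf.Hom.app τ fone X (fun _ => a) PUnit.unit)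
    fun X Y f a => congrFun (StrongProf.naturality τ (𝟙 fone) f fun _ => a) PUnit.unit, ?_⟩
  ext X Y v
  funext x
  have e := congrFun (StrongProf.naturality τ (fpoint x) (𝟙 Y) v) PUnit.unit
  have h₁ : (lowerStar.obj F).map (fpoint x) (𝟙 Y) v = fun _ => v x := by
    funext y
    exact F.map_id (v x)
  rw [h₁] at e
  exact e.trans (G.map_id _)

/-- The lifting of `(-)_*` to a functor from finitary monads to `◇`-monoids. -/
def comparison : Mon FinFunctor.{u} ⥤ MonadMon diamond.{u} where
  obj F :=
    { toMon := lowerStar.mapMon.obj F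
      a := lowerStar.map (kleisliCounit F.X)
      unit := kleisliAdjunction.right_triangle_components F.X
      -- Both composites evaluate twice at the element of `1`.
      assoc := rfl }
  map τ :=
    { toHom := lowerStar.mapMon.map τ
      map_comp := rfl }
  map_id F := MonadMon.Hom.ext (lowerStar.mapMon.map_id F)
  map_comp σ τ := MonadMon.Hom.ext (lowerStar.mapMon.map_comp σ τ)

instance : comparison.{u}.Faithful where
  map_injective {F G σ τ} h := by
    ext1
    apply lowerStar_map_injective
    exact congrArg (fun ρ : comparison.obj F ⟶ comparison.obj G => ρ.toHom.hom) h

/-- The underlying map is `σ_*` for some `σ`. The monoid equations for `σ_*` are those for `σ`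
precomposed with `ξ₀` and `ξ`, which can be cancelled. -/
instance : comparison.{u}.Full where
  map_surjective {F G} τ := by
    obtain ⟨σ, hσ⟩ := exists_lowerStar_map (F := F.X) (G := G.X) τ.toHom.hom
    have h_one : MonObj.one (X := F.X) ≫ σ = MonObj.one (X := G.X) := by
      apply hom_ext_of_xiZero
      have e := IsMonHom.one_hom τ.toHom.hom
      rw [← hσ] at e
      rw [Functor.map_comp]
      exact e
    have h_mul : MonObj.mul (X := F.X) ≫ σ = (σ ⊗ₘ σ) ≫ MonObj.mul (X := G.X) := by
      apply hom_ext_of_xi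
      have e := IsMonHom.mul_hom τ.toHom.hom
      rw [← hσ] at e
      -- Naturality of `ξ` moves `σ_* ⊗ σ_*` past it, so that `ξ` stands in front of both sides.
      have n := Functor.LaxMonoidal.μ_natural lowerStar.{u} σ σ
      rw [Functor.map_comp, Functor.map_comp]
      refine (Category.assoc _ _ _).symm.trans (e.trans ?_)
      refine (Category.assoc _ _ _).symm.trans ((congrArg (· ≫ _) n).trans ?_)
      exact Category.assoc _ _ _
    refine ⟨Mon.Hom.mk' σ h_one h_mul, ?_⟩
    apply MonadMon.Hom.ext
    ext1
    exact hσ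

/-! ### The finitary monad of an arrow with invertible `eval` -/

section UpperMonoid

variable (A : StrongProf.{u})

/-- The element of `A(X, Y)` with values `v`. -/
def uncurry [IsIso (kleisliUnit A)] {X Y : FintypeCat.{u}} (v : X → A.obj fone Y) : A.obj X Y :=
  StrongProf.Hom.app (inv (kleisliUnit A)) X Y v

variable [IsIso (kleisliUnit A)]

theorem map_fpoint_uncurry {X Y : FintypeCat.{u}} (v : X → A.obj fone Y) (x : X) :
    A.map (fpoint x) (𝟙 Y) (uncurry A v) = v x := by
  have e := congrArg (fun τ => StrongProf.Hom.app τ X Y v) (IsIso.inv_hom_id (kleisliUnit A))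
  exact congrFun e x

/-- Injectivity of `η_A`: an element of `A(X, Y)` is determined by its restrictions to points. The
identities for `A^*` below are checked in this way. -/
theorem uncurry_eq {X Y : FintypeCat.{u}} (v : X → A.obj fone Y) (p : A.obj X Y)
    (h : ∀ x, A.map (fpoint x) (𝟙 Y) p = v x) : uncurry A v = p := by
  obtain rfl : (fun x => A.map (fpoint x) (𝟙 Y) p) = v := funext h
  exact congrArg (fun τ => StrongProf.Hom.app τ X Y p) (IsIso.hom_inv_id (kleisliUnit A))

theorem uncurry_comp {X X' Y : FintypeCat.{u}} (f : X' ⟶ X) (v : X → A.obj fone Y) :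
    uncurry A (fun x => v (f x)) = A.map f (𝟙 Y) (uncurry A v) := by
  apply uncurry_eq
  intro x
  rw [StrongProf.map_map, Category.comp_id, ← map_fpoint_uncurry A v]
  rfl

theorem uncurry_map {X Y Y' : FintypeCat.{u}} (g : Y ⟶ Y') (v : X → A.obj fone Y) :
    uncurry A (fun x => A.map (𝟙 fone) g (v x)) = A.map (𝟙 X) g (uncurry A v) := by
  apply uncurry_eq
  intro x
  rw [← map_fpoint_uncurry A v, StrongProf.map_map, StrongProf.map_map]
  rfl

variable [MonObj A]

/-- The unit of the finitary monad `A^*`. -/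
def upperOne : FinFunctor.incl.{u} ⟶ upperStar.obj A :=
  FinFunctor.homMk (F := FinFunctor.incl) (G := upperStar.obj A)
    (fun X x => arr A (fpoint (X := X) x)) (fun _ _ f x => (map_arr A (𝟙 fone) (fpoint x) f).symm)

/-- The components `[a, k] ↦ a >>> k` of the multiplication of `A^*`. -/
def upperMulApp (X : FintypeCat.{u}) :
    (FinFunctor.subst (upperStar.obj A) (upperStar.obj A)).obj X → A.obj fone X :=
  FinFunctor.desc (F := upperStar.obj A) (G := upperStar.obj A)
    (fun _ a k => seqComp A a (uncurry A k))
    (by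
      -- Reindexing along `f` passes from `k` to `uncurry k`, and then across `>>>` to `a`.
      intro C D f (a : A.obj fone C) (k : D → A.obj fone X)
      exact (congrArg (seqComp A a) (uncurry_comp A f k)).trans (seqComp_map A f a _))

theorem upperMulApp_mk {X : FintypeCat.{u}} (C : FintypeCat.{u}) (a : A.obj fone C)
    (k : C → A.obj fone X) :
    upperMulApp A X (FinFunctor.mk' (F := upperStar.obj A) (G := upperStar.obj A) C a k) =
      seqComp A a (uncurry A k) :=
  FinFunctor.desc_mk' (F := upperStar.obj A) (G := upperStar.obj A) _ _ C a k

/-- The multiplication of the finitary monad `A^*`. -/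
def upperMul : FinFunctor.subst (upperStar.obj A) (upperStar.obj A) ⟶ upperStar.obj A :=
  FinFunctor.homMk (F := FinFunctor.subst (upperStar.obj A) (upperStar.obj A))
    (G := upperStar.obj A) (upperMulApp A)
    (by
      intro X Y f x
      induction x using FinFunctor.ind with | _ C a k
      rw [FinFunctor.subst_map]
      refine (upperMulApp_mk A C a _).trans ?_
      refine (congrArg (seqComp A a) (uncurry_map A f k)).trans ?_
      refine Eq.trans ?_ (congrArg (A.map (𝟙 fone) f) (upperMulApp_mk A C a k)).symm
      refine Eq.trans ?_ (map_seqComp A (𝟙 fone) f a (uncurry A k)).symm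
      exact congrArg (fun b => seqComp A b _) (A.map_id a).symm)

theorem upperMul_mk {X : FintypeCat.{u}} (C : FintypeCat.{u}) (a : A.obj fone C)
    (k : C → A.obj fone X) :
    FinFunctor.Hom.app (upperMul A) X
      (FinFunctor.mk' (F := upperStar.obj A) (G := upperStar.obj A) C a k) =
        seqComp A a (uncurry A k) :=
  upperMulApp_mk A C a k

/-- The finitary monad `A^*`. -/
abbrev upperMonObj : MonObj (upperStar.obj A) where
  one := upperOne A
  mul := upperMul A
  one_mul := by
    ext X x
    induction x using FinFunctor.ind with | _ C c k
    change FinFunctor.Hom.app (upperMul A) X (FinFunctor.Hom.app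
      (FinFunctor.substMap (upperOne A) (𝟙 (upperStar.obj A))) X (FinFunctor.mk' C c k)) =
        FinFunctor.Hom.app (FinFunctor.leftUnitorHom (upperStar.obj A)) X (FinFunctor.mk' C c k)
    rw [FinFunctor.leftUnitorHom_mk, FinFunctor.substMap_mk]
    refine (upperMul_mk A C _ _).trans ?_
    exact (arr_seqComp A _ _).trans (map_fpoint_uncurry A k c)
  mul_one := by
    ext X x
    induction x using FinFunctor.ind with | _ C a k
    change FinFunctor.Hom.app (upperMul A) X (FinFunctor.Hom.app
      (FinFunctor.substMap (𝟙 (upperStar.obj A)) (upperOne A)) X (FinFunctor.mk' C a k)) =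
        FinFunctor.Hom.app (FinFunctor.rightUnitorHom (upperStar.obj A)) X (FinFunctor.mk' C a k)
    rw [FinFunctor.rightUnitorHom_mk, FinFunctor.substMap_mk]
    refine (upperMul_mk A C _ _).trans ?_
    -- The family of units `c ↦ arr (k c)` uncurries to `arr k`, so the right unit law of the arrow
    -- applies.
    refine Eq.trans (congrArg (seqComp A a) (uncurry_eq A _
      (arr A (FintypeCat.homMk (X := C) (Y := X) k)) fun c => ?_)) (seqComp_arr A a _)
    exact map_arr A _ _ _
  mul_assoc := by
    ext X x
    induction x using FinFunctor.ind with | _ D x h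
    induction x using FinFunctor.ind with | _ C a g
    change FinFunctor.Hom.app (upperMul A) X (FinFunctor.Hom.app
      (FinFunctor.substMap (upperMul A) (𝟙 (upperStar.obj A))) X
        (FinFunctor.mk' D (FinFunctor.mk' C a g) h)) =
      FinFunctor.Hom.app (upperMul A) X (FinFunctor.Hom.app
        (FinFunctor.substMap (𝟙 (upperStar.obj A)) (upperMul A)) X
          (FinFunctor.Hom.app (FinFunctor.associatorHom _ _ _) X
            (FinFunctor.mk' D (FinFunctor.mk' C a g) h)))
    rw [FinFunctor.associatorHom_mk, FinFunctor.substMap_mk, FinFunctor.substMap_mk]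
    refine (upperMul_mk A D _ _).trans (Eq.trans ?_ (upperMul_mk A C _ _).symm)
    refine (congrArg (fun b => seqComp A b (uncurry A h)) (upperMul_mk A C a g)).trans ?_
    refine (seqComp_assoc A _ _ _).trans ?_
    -- After associativity in `A`, it remains to compare second factors pointwise: `uncurry g >>>
    -- uncurry h` restricts at `c` to `g c >>> uncurry h`.
    refine congrArg (seqComp A a) (uncurry_eq A _ _ fun c => ?_).symm
    refine (map_fpoint_seqComp A (uncurry A g) (uncurry A h) c).trans ?_
    refine (congrArg (fun b => seqComp A b (uncurry A h)) (map_fpoint_uncurry A g c)).trans ?_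
    exact (upperMul_mk A D (g c) h).symm

end UpperMonoid

/-- The finitary monad `A^*`, bundled. -/
def upperMon (A : Mon StrongProf.{u}) [IsIso (kleisliUnit A.X)] : Mon FinFunctor.{u} where
  X := upperStar.obj A.X
  mon := upperMonObj A.X

/-- The Kleisli unit as a morphism of arrows. -/
def upperMonHom (A : Mon StrongProf.{u}) [IsIso (kleisliUnit A.X)] :
    A ⟶ lowerStar.mapMon.obj (upperMon A) :=
  Mon.Hom.mk' (kleisliUnit A.X)
    (by
      ext X Y f
      funext x
      exact map_arr A.X (fpoint x) f (𝟙 Y))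
    (by
      ext X Y x
      induction x using StrongProf.ind with | _ W c d
      funext x
      have h₁ : StrongProf.Hom.app (StrongProf.tensorMap (kleisliUnit A.X) (kleisliUnit A.X)) X Y
          (StrongProf.mk' W c d) = _ := StrongProf.tensorMap_mk _ _ W c d
      have h₂ := (congrArg (StrongProf.Hom.app (xi (upperStar.obj A.X) (upperStar.obj A.X)) X Y)
        h₁).trans (xi_mk _ _ X Y W _ _)
      have h₃ := congrArg (FinFunctor.Hom.app (upperMul A.X) Y) (congrFun h₂ x)
      refine Eq.trans ?_ (h₃.trans (upperMul_mk A.X W _ _)).symm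
      refine (map_fpoint_seqComp A.X c d x).trans ?_
      -- Multiplying in `A^*` uncurries the values of `d`, which gives back `d`.
      exact congrArg (seqComp A.X _) (uncurry_eq A.X _ d fun _ => rfl).symm)

instance (A : Mon StrongProf.{u}) [h : IsIso (kleisliUnit A.X)] : IsIso (upperMonHom A) := by
  have : IsIso ((Mon.forget StrongProf).map (upperMonHom A)) := h
  exact isIso_of_reflects_iso (upperMonHom A) (Mon.forget StrongProf)

/-- It is enough to have an isomorphism of underlying arrows, namely the Kleisli unit: the algebra
structures are matched by full faithfulness of the forgetful functor. -/
instance : comparison.{u}.EssSurj where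
  mem_essImage M := by
    have := M.isIso_unit
    exact ⟨upperMon M.toMon,
      ⟨(MonadMon.forget diamond).preimageIso (asIso (upperMonHom M.toMon)).symm⟩⟩

instance : comparison.{u}.IsEquivalence where

end

end Computation

theorem mainTheorem9 :
    -- `(ξ₀)^* : Hom^* ⟶ (i_*)^*` is invertible
    IsIso (Computation.upperStar.{u}.map (Functor.LaxMonoidal.ε Computation.lowerStar.{u})) ∧
    -- `(ξ ∘ (η ⊗ id))^* : (P ⊗ F_*)^* ⟶ ((P^* ∘ F)_*)^*` is invertible
    (∀ (P : Computation.StrongProf.{u}) (F : Computation.FinFunctor.{u}),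
      IsIso (Computation.upperStar.map
        (Computation.kleisliAdjunction.unit.app P ▷ Computation.lowerStar.obj F ≫
          Functor.LaxMonoidal.μ Computation.lowerStar (Computation.upperStar.obj P) F))) ∧
    -- `Mon [𝔽, 𝕊]_∘` and `Mon(◇)` are equivalent, through the lifting of `(-)_*` to monoids
    (∃ e : Mon Computation.FinFunctor.{u} ≌ Computation.MonadMon Computation.diamond.{u},
      Nonempty (e.functor ⋙ Computation.MonadMon.forget Computation.diamond ≅
        Computation.lowerStar.mapMon)) ∧
    -- `Mon(◇)` is the full subcategory of those arrows for which `eval` is invertible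
    (Computation.MonadMon.forget Computation.diamond.{u}).Full ∧
    (Computation.MonadMon.forget Computation.diamond.{u}).Faithful ∧
    (∀ A : Mon Computation.StrongProf.{u},
      (∃ M : Computation.MonadMon Computation.diamond.{u}, M.toMon = A) ↔
        ∀ X Y : FintypeCat.{u}, Function.Bijective (Computation.eval A.X X Y)) := by
  exact ⟨Computation.isIso_upperStar_xiZero, Computation.isIso_upperStar_unit_xi,
    -- Forgetting the algebra structure of `comparison` returns `lowerStar.mapMon` definitionally.
    ⟨Computation.comparison.asEquivalence, ⟨Iso.refl _⟩⟩, inferInstance, inferInstance,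
    Computation.exists_monadMon_iff⟩
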